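/- Let $n \ge 1$, $\mathbb{D} = \{z \in \mathbb{C} : |z| < 1\}$, $I = (-1,1)$. A $C^4$-smooth *Levi-flat manifold* of dimension $2n+1$ is a manifold $M$ with an atlas of charts $(z,t) : U \to \mathbb{D}^n \times I$ (*foliated charts*) whose coordinate changes are $C^4$-smooth and locally of the form $z' = z'(z,t)$, $t' = t'(t)$ with $z'$ holomorphic in $z$. The sets $\{t = \mathrm{const}\}$ are glued to the leaves of the *Levi foliation* $\mathcal{F}$, which are $n$-dimensional complex manifolds; $T^{1,0}\mathcal{F}$ is their holomorphic tangent bundle, spanned by $\partial/\partial z^1, \dots, \partial/\partial z^n$ in a foliated chart. A *transverse measure* $\mu$ of $\mathcal{F}$ with $C^3$-smooth positive density is given in each foliated chart by $\mu = h(z,t)\,|dt|$ on the transversals $\{z\} \times I$, where $h > 0$ is a $C^3$-smooth function on $\mathbb{D}^n \times I$, subject to $h(z,t) = h'(z',t')\,|dt'/dt|$ on overlaps of charts (holonomy invariance is not required). It determines the Hermitian forms on $T^{1,0}\mathcal{F}$ given in each foliated chart, for $\zeta = \sum_\alpha \zeta^\alpha\, \partial/\partial z^\alpha$, by $$ iA_\mu(\zeta,\bar\zeta)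 = \sum_{\alpha,\beta=1}^n \frac{\partial \log h}{\partial z^\alpha}\frac{\partial \log h}{\partial \bar z^\beta}\, \zeta^\alpha \overline{\zeta^\beta}, \qquad i\Theta_\mu(\zeta,\bar\zeta) = \sum_{\alpha,\beta=1}^n \frac{\partial^2(-\log h)}{\partial z^\alpha \partial \bar z^\beta}\, \zeta^\alpha \overline{\zeta^\beta}; $$ they do not depend on the chart. **Theorem.** Let $M$ be a non-empty oriented compact $C^4$-smooth Levi-flat manifold of dimension $2n+1$, $n \ge 1$, with Levi foliation $\mathcal{F}$. Suppose that $M$ can be realized in an $(n+1)$-dimensional complex manifold $X$ as the boundary of a relatively compact domain $\Omega \Subset X$, that is, there is a $C^4$-smooth embedding $\iota : M \to X$, holomorphic along the leaves of $\mathcal{F}$, with $\iota(M) = \partial\Omega$. Then for every transverse measure $\mu$ of $\mathcal{F}$ with $C^3$-smooth positive density there exists a non-zero vector $\zeta \in T^{1,0}\mathcal{F}$ such that $$ iA_\mu(\zeta,\bar\zeta) \ge n\, i\Theta_\mu(\zeta,\bar\zeta). $$ -/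

import Mathlib

open Set Filter Topology
open scoped Manifold ContDiff

noncomputable section

namespace LeviFlat

/-- The local model `ℂⁿ × ℝ` with coordinates `(z, t)`: `z` is the leaf direction and `t` the
transverse direction. -/
abbrev Model (n : ℕ) : Type := (Fin n → ℂ) × ℝ

/-- The box `𝔻ⁿ × I`, with `𝔻` the open unit disc of `ℂ` and `I = (-1, 1)`. -/
def box (n : ℕ) : Set (Model n) :=
  {x | (∀ j, ‖x.1 j‖ < 1) ∧ x.2 ∈ Ioo (-1 : ℝ) 1}

/-- The coordinate change from the chart `e` to the chart `e'`, with domain `e (U ∩ U')`. -/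
abbrev transition {n : ℕ} {M : Type*} [TopologicalSpace M]
    (e e' : OpenPartialHomeomorph M (Model n)) : OpenPartialHomeomorph (Model n) (Model n) :=
  e.symm.trans e'

/-- A `C^k` Levi-flat structure of dimension `2n + 1` on `M`: an atlas of charts
`(z, t) : U → 𝔻ⁿ × I` whose coordinate changes are `C^k`, holomorphic in `z`, and of the form
`z' = z'(z, t)`, `t' = t'(t)`. The last condition is imposed locally (near each point of the
overlap, `t'` is constant along the plaque `t = const`), as usual for foliations. -/
structure Structure (n : ℕ) (k : WithTop ℕ∞) (M : Type*) [TopologicalSpace M] where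
  /-- the foliated charts -/
  atlas : Set (OpenPartialHomeomorph M (Model n))
  cover : ∀ p : M, ∃ e ∈ atlas, p ∈ e.source
  target_eq : ∀ e ∈ atlas, e.target = box n
  contDiffOn : ∀ e ∈ atlas, ∀ e' ∈ atlas,
    ContDiffOn ℝ k (transition e e') (transition e e').source
  transverse : ∀ e ∈ atlas, ∀ e' ∈ atlas, ∀ x ∈ (transition e e').source,
    ∀ᶠ y in 𝓝 x, y.2 = x.2 → (transition e e' y).2 = (transition e e' x).2
  holomorphic : ∀ e ∈ atlas, ∀ e' ∈ atlas, ∀ x ∈ (transition e e').source,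
    DifferentiableAt ℂ (fun z : Fin n → ℂ => (transition e e' (z, x.2)).1) x.1

section

variable {n : ℕ} {k : WithTop ℕ∞} {M : Type*} [TopologicalSpace M]

/-- `M` is orientable. The chart domains are connected, so an orientation of `M` is a choice of
sign for each chart (whether the chart preserves or reverses orientation) that is compatible with
the signs of the Jacobian determinants of the coordinate changes. -/
def Structure.Orientable (F : Structure n k M) : Prop :=
  ∃ σ : OpenPartialHomeomorph M (Model n) → ℝ,
    (∀ e ∈ F.atlas, σ e = 1 ∨ σ e = -1) ∧
    ∀ e ∈ F.atlas, ∀ e' ∈ F.atlas, ∀ x ∈ (transition e e').source,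
      0 < σ e * σ e' * (fderiv ℝ (transition e e') x).det

/-- A transverse measure of the Levi foliation with `C^r` positive density with respect to the
transverse Lebesgue measures. It is given by `h(z, t) |dt|` on the transversals `{z} × I` of each
foliated chart, where `h = density e`; the expressions in two charts agree, that is
`h(z, t) |dt| = h'(z', t') |dt'|`. No invariance under holonomy is required. -/
structure TransverseMeasure (F : Structure n k M) (r : WithTop ℕ∞) where
  /-- the density `h` in each foliated chart -/
  density : OpenPartialHomeomorph M (Model n) → Model n → ℝ
  pos : ∀ e ∈ F.atlas, ∀ x ∈ box n, 0 < density e x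
  contDiffOn : ∀ e ∈ F.atlas, ContDiffOn ℝ r (density e) (box n)
  compatible : ∀ e ∈ F.atlas, ∀ e' ∈ F.atlas, ∀ x ∈ (transition e e').source,
    density e x = density e' (transition e e' x) *
      |deriv (fun s : ℝ => (transition e e' (x.1, s)).2) x.2|

/-- The Wirtinger derivative `∂f/∂z^α` at `z`. -/
def dz (α : Fin n) (f : (Fin n → ℂ) → ℂ) (z : Fin n → ℂ) : ℂ :=
  (fderiv ℝ f z (Pi.single α 1) - Complex.I * fderiv ℝ f z (Pi.single α Complex.I)) / 2

/-- The Wirtinger derivative `∂f/∂z̄^α` at `z`. -/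
def dzbar (α : Fin n) (f : (Fin n → ℂ) → ℂ) (z : Fin n → ℂ) : ℂ :=
  (fderiv ℝ f z (Pi.single α 1) + Complex.I * fderiv ℝ f z (Pi.single α Complex.I)) / 2

variable {F : Structure n k M} {r : WithTop ℕ∞}

/-- The function `z ↦ log h(z, t)` on the plaque `t = const` of the chart `e`. -/
def TransverseMeasure.logDensity (μ : TransverseMeasure F r)
    (e : OpenPartialHomeomorph M (Model n)) (t : ℝ) (z : Fin n → ℂ) : ℂ :=
  (Real.log (μ.density e (z, t)) : ℂ)

/-- The Hermitian form `iA_μ(ζ, ζ̄) = ∑ (∂ log h/∂z^α) (∂ log h/∂z̄^β) ζ^α ζ̄^β` at the point with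
coordinates `x = (z, t)` in the foliated chart `e`, on the vector `ζ = ∑ ζ^α ∂/∂z^α` of
`T^{1,0}F`. Its value is a real number. -/
def TransverseMeasure.formA (μ : TransverseMeasure F r)
    (e : OpenPartialHomeomorph M (Model n)) (x : Model n) (ζ : Fin n → ℂ) : ℝ :=
  (∑ α, ∑ β, dz α (μ.logDensity e x.2) x.1 * dzbar β (μ.logDensity e x.2) x.1 *
    ζ α * starRingEnd ℂ (ζ β)).re

/-- The Hermitian form `iΘ_μ(ζ, ζ̄) = ∑ (∂² (-log h)/∂z^α∂z̄^β) ζ^α ζ̄^β` at the point with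
coordinates `x = (z, t)` in the foliated chart `e`, on the vector `ζ = ∑ ζ^α ∂/∂z^α` of
`T^{1,0}F`. Its value is a real number. -/
def TransverseMeasure.formTheta (μ : TransverseMeasure F r)
    (e : OpenPartialHomeomorph M (Model n)) (x : Model n) (ζ : Fin n → ℂ) : ℝ :=
  (∑ α, ∑ β, dz α (dzbar β (fun z => -μ.logDensity e x.2 z)) x.1 *
    ζ α * starRingEnd ℂ (ζ β)).re

/-- `ι` realizes the Levi-flat manifold `M` as a `C^k` real hypersurface of the complex manifold
`X`: it is a `C^k` embedding (a topological embedding and, in the foliated charts, a `C^k`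
immersion) that is holomorphic along the leaves. -/
structure IsRealization (F : Structure n k M) {X : Type*} [TopologicalSpace X]
    [ChartedSpace (Fin (n + 1) → ℂ) X] (ι : M → X) : Prop where
  isEmbedding : IsEmbedding ι
  contMDiffOn : ∀ e ∈ F.atlas,
    ContMDiffOn 𝓘(ℝ, Model n) 𝓘(ℝ, Fin (n + 1) → ℂ) k (ι ∘ e.symm) (box n)
  immersion : ∀ e ∈ F.atlas, ∀ x ∈ box n,
    Function.Injective (mfderiv 𝓘(ℝ, Model n) 𝓘(ℝ, Fin (n + 1) → ℂ) (ι ∘ e.symm) x)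
  holomorphic : ∀ e ∈ F.atlas, ∀ x ∈ box n,
    MDifferentiableAt 𝓘(ℂ, Fin n → ℂ) 𝓘(ℂ, Fin (n + 1) → ℂ)
      (fun z : Fin n → ℂ => ι (e.symm (z, x.2))) x.1

end

end LeviFlat

end

/-!
The statement is a consequence of Stokes' theorem on `M`. Write `u = -log h` in each foliated
chart. On overlaps `u` changes by a function that is constant on plaques, so the leafwise forms
`∂u`, `∂̄u` and `∂∂̄u` are global, and `h |dt|` turns leafwise forms of top degree into densities on
`M`. Since `∂h = -h ∂u` along the leaves,

  `d (h |dt| ∧ ∂̄u ∧ (∂∂̄u)^(n-1)) = h |dt| ∧ ((∂∂̄u)^n - ∂u ∧ ∂̄u ∧ (∂∂̄u)^(n-1))`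

up to a constant factor, and the integral of the right hand side over `M` vanishes. Suppose
`iA_μ < n iΘ_μ` on all non-zero vectors. Then `iΘ_μ` is positive definite, and evaluating the
inequality at the vector dual to `∂u` shows that the squared norm of `∂u` with respect to `iΘ_μ` is
less than `n`, that is, that the right hand side is everywhere positive: a contradiction.

Differential forms are avoided. With `Θ` the complex Hessian of `u` on the plaques, the form on the
left is the vector density `V^α = h ∑ (∂u/∂z̄^β) adj(Θ)^{βα}` (`vectorDensity`). Its divergence is
`h (n det Θ - ∑ (∂u/∂z̄^β) adj(Θ)^{βα} (∂u/∂z^α))` (`sum_plaqueDz_mul_vectorDensity`), because the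
rows of `adj(Θ)` are divergence free (`sum_dz_adjugate_complexHessian`, from Jacobi's formula for
the derivative of a determinant and the symmetry of the third derivatives of `u`), and it is
positive under the assumption above (`divergence_pos`).

To integrate over `M`, take a finite partition of unity `χ i` with `χ i` compactly supported in the
chart `c i`. Integration by parts in each chart gives
`∑ i, ∫ χ i div V = -∑ i, ∫ V (χ i) = -∑ i, ∑ j, ∫ χ j V (χ i)`.
The density `V (χ i)` does not depend on the chart (`fluxDensity_transition`), so the terms of
the double sum can be computed in the chart `c j`, where they add up to
`∑ j, ∫ χ j V (∑ i, χ i) = ∑ j, ∫ χ j V (1) = 0` (`false_of_divergence_pos`).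
-/

namespace LeviFlat

open Complex ComplexConjugate Matrix

/-! ### Wirtinger calculus -/

section Wirtinger

variable {n : ℕ} {f g : (Fin n → ℂ) → ℂ} {z : Fin n → ℂ}

lemma dz_congr (h : f =ᶠ[𝓝 z] g) (α : Fin n) : dz α f z = dz α g z := by
  simp only [dz, h.fderiv_eq]

lemma dzbar_congr (h : f =ᶠ[𝓝 z] g) (α : Fin n) : dzbar α f z = dzbar α g z := by
  simp only [dzbar, h.fderiv_eq]

lemma dz_const (α : Fin n) (c : ℂ) : dz α (fun _ => c) z = 0 := by simp [dz]

lemma dz_neg (α : Fin n) : dz α (fun z => -f z) z = -dz α f z := by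
  simp only [dz, fderiv_fun_neg, _root_.neg_apply]; ring

lemma dzbar_neg (α : Fin n) : dzbar α (fun z => -f z) z = -dzbar α f z := by
  simp only [dzbar, fderiv_fun_neg, _root_.neg_apply]; ring

lemma dzbar_sub_const (α : Fin n) (c : ℂ) : dzbar α (fun z => f z - c) z = dzbar α f z := by
  simp only [dzbar, fderiv_sub_const]

lemma dz_mul (hf : DifferentiableAt ℝ f z) (hg : DifferentiableAt ℝ g z) (α : Fin n) :
    dz α (fun z => f z * g z) z = f z * dz α g z + dz α f z * g z := by
  simp only [dz, fderiv_fun_mul hf hg, _root_.add_apply,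
    _root_.smul_apply, smul_eq_mul]; ring

lemma dz_sum {ι : Type*} (s : Finset ι) {f : ι → (Fin n → ℂ) → ℂ}
    (hf : ∀ i ∈ s, DifferentiableAt ℝ (f i) z) (α : Fin n) :
    dz α (fun z => ∑ i ∈ s, f i z) z = ∑ i ∈ s, dz α (f i) z := by
  simp only [dz, fderiv_fun_sum hf, _root_.sum_apply, Finset.mul_sum,
    Finset.sum_div, ← Finset.sum_sub_distrib]

lemma conj_dz (α : Fin n) : conj (dz α f z) = dzbar α (fun z => conj (f z)) z := by
  have : fderiv ℝ (fun z => conj (f z)) z = (conjCLE : ℂ →L[ℝ] ℂ).comp (fderiv ℝ f z) :=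
    conjCLE.comp_fderiv
  simp [dz, dzbar, this, sub_neg_eq_add, Complex.conj_ofNat]

lemma conj_dzbar (α : Fin n) : conj (dzbar α f z) = dz α (fun z => conj (f z)) z := by
  have : fderiv ℝ (fun z => conj (f z)) z = (conjCLE : ℂ →L[ℝ] ℂ).comp (fderiv ℝ f z) :=
    conjCLE.comp_fderiv
  simp [dz, dzbar, this, sub_eq_add_neg, Complex.conj_ofNat]

/-- A real-linear functional on `ℂⁿ` is the sum of its complex-linear and its
conjugate-linear part. -/
lemma clm_apply_eq_sum (l : (Fin n → ℂ) →L[ℝ] ℂ) (v : Fin n → ℂ) :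
    l v = ∑ γ, ((l (Pi.single γ 1) - I * l (Pi.single γ I)) / 2 * v γ +
      (l (Pi.single γ 1) + I * l (Pi.single γ I)) / 2 * conj (v γ)) := by
  have hv : v = ∑ γ, ((v γ).re • (Pi.single γ 1 : Fin n → ℂ) +
      (v γ).im • (Pi.single γ I : Fin n → ℂ)) := by
    funext j
    simp only [Finset.sum_apply, Pi.add_apply, Pi.smul_apply, Finset.sum_add_distrib]
    rw [Finset.sum_eq_single j (by intro b _ hb; simp [Pi.single_eq_of_ne' hb]) (by simp),
      Finset.sum_eq_single j (by intro b _ hb; simp [Pi.single_eq_of_ne' hb]) (by simp)]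
    simp only [Pi.single_eq_same, real_smul, mul_one, re_add_im]
  conv_lhs => rw [hv]
  simp only [map_sum, map_add, map_smul, real_smul]
  refine Finset.sum_congr rfl fun γ _ => ?_
  have h1 := re_add_im (v γ)
  have h2 : conj (v γ) = (v γ).re - (v γ).im * I := by
    apply Complex.ext <;> simp
  rw [h2]
  nth_rw 3 [← h1]
  linear_combination ((v γ).im * l (Pi.single γ I)) * I_sq

lemma fderiv_comp_holomorphic {w : (Fin n → ℂ) → Fin n → ℂ}
    (hg : DifferentiableAt ℝ g (w z)) (hw : DifferentiableAt ℂ w z) (v : Fin n → ℂ) :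
    fderiv ℝ (fun z => g (w z)) z v = fderiv ℝ g (w z) (fderiv ℂ w z v) := by
  have hw' : HasFDerivAt w ((fderiv ℂ w z).restrictScalars ℝ) z :=
    hw.hasFDerivAt.restrictScalars ℝ
  have h := (hg.hasFDerivAt.comp z hw').fderiv
  rw [Function.comp_def] at h
  rw [h]
  rfl

lemma fderiv_single_I {w : (Fin n → ℂ) → Fin n → ℂ} (α γ : Fin n) :
    fderiv ℂ w z (Pi.single α I) γ = I * fderiv ℂ w z (Pi.single α 1) γ := by
  have : (Pi.single α I : Fin n → ℂ) = I • Pi.single α 1 := by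
    rw [← Pi.single_smul]; simp
  rw [this, map_smul]; rfl

lemma dz_comp {w : (Fin n → ℂ) → Fin n → ℂ}
    (hg : DifferentiableAt ℝ g (w z)) (hw : DifferentiableAt ℂ w z) (α : Fin n) :
    dz α (fun z => g (w z)) z = ∑ γ, dz γ g (w z) * fderiv ℂ w z (Pi.single α 1) γ := by
  rw [dz, fderiv_comp_holomorphic hg hw, fderiv_comp_holomorphic hg hw,
    clm_apply_eq_sum, clm_apply_eq_sum _ (fderiv ℂ w z (Pi.single α I)), Finset.mul_sum,
    ← Finset.sum_sub_distrib, Finset.sum_div]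
  refine Finset.sum_congr rfl fun γ _ => ?_
  rw [fderiv_single_I, map_mul, conj_I]
  simp only [dz]
  ring_nf
  simp only [I_sq]
  have h3 : I ^ 3 = -I := by rw [pow_succ, I_sq]; ring
  simp only [h3]
  ring

lemma dzbar_comp {w : (Fin n → ℂ) → Fin n → ℂ}
    (hg : DifferentiableAt ℝ g (w z)) (hw : DifferentiableAt ℂ w z) (α : Fin n) :
    dzbar α (fun z => g (w z)) z =
      ∑ γ, dzbar γ g (w z) * conj (fderiv ℂ w z (Pi.single α 1) γ) := by
  rw [dzbar, fderiv_comp_holomorphic hg hw, fderiv_comp_holomorphic hg hw,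
    clm_apply_eq_sum, clm_apply_eq_sum _ (fderiv ℂ w z (Pi.single α I)), Finset.mul_sum,
    ← Finset.sum_add_distrib, Finset.sum_div]
  refine Finset.sum_congr rfl fun γ _ => ?_
  rw [fderiv_single_I, map_mul, conj_I]
  simp only [dzbar]
  ring_nf
  simp only [I_sq]
  have h3 : I ^ 3 = -I := by rw [pow_succ, I_sq]; ring
  simp only [h3]
  ring

lemma fderiv_fderiv_apply (hf : ContDiffAt ℝ 2 f z) (v w : Fin n → ℂ) :
    fderiv ℝ (fun z => fderiv ℝ f z v) z w = fderiv ℝ (fderiv ℝ f) z w v := by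
  have h : DifferentiableAt ℝ (fderiv ℝ f) z :=
    (hf.fderiv_right (m := 1) (by norm_num)).differentiableAt one_ne_zero
  rw [fderiv_clm_apply h (differentiableAt_const v)]
  simp

lemma fderiv_fderiv_comm (hf : ContDiffAt ℝ 2 f z) (v w : Fin n → ℂ) :
    fderiv ℝ (fun z => fderiv ℝ f z v) z w = fderiv ℝ (fun z => fderiv ℝ f z w) z v := by
  rw [fderiv_fderiv_apply hf, fderiv_fderiv_apply hf]
  exact hf.isSymmSndFDerivAt (by simp) w v

lemma differentiableAt_fderiv_apply (hf : ContDiffAt ℝ 2 f z) (v : Fin n → ℂ) :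
    DifferentiableAt ℝ (fun z => fderiv ℝ f z v) z :=
  ((hf.fderiv_right (m := 1) (by norm_num)).differentiableAt one_ne_zero).clm_apply
    (differentiableAt_const v)

lemma fderiv_dz (hf : ContDiffAt ℝ 2 f z) (α : Fin n) (v : Fin n → ℂ) :
    fderiv ℝ (dz α f) z v = (fderiv ℝ (fun z => fderiv ℝ f z (Pi.single α 1)) z v -
      I * fderiv ℝ (fun z => fderiv ℝ f z (Pi.single α I)) z v) / 2 := by
  have h1 := differentiableAt_fderiv_apply hf (Pi.single α 1)
  have h2 := differentiableAt_fderiv_apply hf (Pi.single α I)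
  have : dz α f = fun z => (2 : ℂ)⁻¹ * (fderiv ℝ f z (Pi.single α 1) -
      I * fderiv ℝ f z (Pi.single α I)) := by
    funext z; rw [dz]; ring
  rw [this, fderiv_const_mul (h1.fun_sub (h2.const_mul I)), fderiv_fun_sub h1 (h2.const_mul I),
    fderiv_const_mul h2]
  simp only [_root_.sub_apply, _root_.smul_apply, smul_eq_mul]
  ring

lemma fderiv_dzbar (hf : ContDiffAt ℝ 2 f z) (α : Fin n) (v : Fin n → ℂ) :
    fderiv ℝ (dzbar α f) z v = (fderiv ℝ (fun z => fderiv ℝ f z (Pi.single α 1)) z v +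
      I * fderiv ℝ (fun z => fderiv ℝ f z (Pi.single α I)) z v) / 2 := by
  have h1 := differentiableAt_fderiv_apply hf (Pi.single α 1)
  have h2 := differentiableAt_fderiv_apply hf (Pi.single α I)
  have : dzbar α f = fun z => (2 : ℂ)⁻¹ * (fderiv ℝ f z (Pi.single α 1) +
      I * fderiv ℝ f z (Pi.single α I)) := by
    funext z; rw [dzbar]; ring
  rw [this, fderiv_const_mul (h1.fun_add (h2.const_mul I)), fderiv_fun_add h1 (h2.const_mul I),
    fderiv_const_mul h2]
  simp only [_root_.add_apply, _root_.smul_apply, smul_eq_mul]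
  ring

lemma dz_dz_comm (hf : ContDiffAt ℝ 2 f z) (α β : Fin n) :
    dz α (dz β f) z = dz β (dz α f) z := by
  rw [dz, dz, fderiv_dz hf, fderiv_dz hf, fderiv_dz hf, fderiv_dz hf,
    fderiv_fderiv_comm hf (Pi.single α 1) (Pi.single β 1),
    fderiv_fderiv_comm hf (Pi.single α 1) (Pi.single β I),
    fderiv_fderiv_comm hf (Pi.single α I) (Pi.single β 1),
    fderiv_fderiv_comm hf (Pi.single α I) (Pi.single β I)]
  ring

lemma dz_dzbar_comm (hf : ContDiffAt ℝ 2 f z) (α β : Fin n) :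
    dz α (dzbar β f) z = dzbar β (dz α f) z := by
  rw [dz, dzbar, fderiv_dz hf, fderiv_dzbar hf, fderiv_dz hf, fderiv_dzbar hf,
    fderiv_fderiv_comm hf (Pi.single α 1) (Pi.single β 1),
    fderiv_fderiv_comm hf (Pi.single α 1) (Pi.single β I),
    fderiv_fderiv_comm hf (Pi.single α I) (Pi.single β 1),
    fderiv_fderiv_comm hf (Pi.single α I) (Pi.single β I)]
  ring

lemma contDiffAt_dz {m k : ℕ∞ω} (hf : ContDiffAt ℝ k f z) (hm : m + 1 ≤ k) (α : Fin n) :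
    ContDiffAt ℝ m (dz α f) z := by
  have h := hf.fderiv_right hm
  have h1 := h.clm_apply (contDiffAt_const (c := (Pi.single α 1 : Fin n → ℂ)))
  have h2 := h.clm_apply (contDiffAt_const (c := (Pi.single α I : Fin n → ℂ)))
  exact (h1.sub (contDiffAt_const.mul h2)).div_const 2

lemma contDiffAt_dzbar {m k : ℕ∞ω} (hf : ContDiffAt ℝ k f z) (hm : m + 1 ≤ k) (α : Fin n) :
    ContDiffAt ℝ m (dzbar α f) z := by
  have h := hf.fderiv_right hm
  have h1 := h.clm_apply (contDiffAt_const (c := (Pi.single α 1 : Fin n → ℂ)))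
  have h2 := h.clm_apply (contDiffAt_const (c := (Pi.single α I : Fin n → ℂ)))
  exact (h1.add (contDiffAt_const.mul h2)).div_const 2

end Wirtinger

/-! ### Derivatives of determinants -/

section MatrixCalculus

variable {n : ℕ} {E : Type*} [NormedAddCommGroup E] [NormedSpace ℝ E]
  {A : E → Matrix (Fin n) (Fin n) ℂ} {x : E}

lemma det_updateRow_eq_sum_adjugate (B : Matrix (Fin n) (Fin n) ℂ) (i : Fin n) (b : Fin n → ℂ) :
    (B.updateRow i b).det = ∑ j, B.adjugate j i * b j := by
  rw [← cramer_transpose_apply, cramer_eq_adjugate_mulVec, ← adjugate_transpose]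
  rfl

/-- Jacobi's formula for the derivative of a determinant. -/
lemma fderiv_det (hA : ∀ i j, DifferentiableAt ℝ (fun y => A y i j) x) (v : E) :
    fderiv ℝ (fun y => (A y).det) x v =
      ∑ i, ∑ j, (A x).adjugate j i * fderiv ℝ (fun y => A y i j) x v := by
  let d : ContinuousMultilinearMap ℂ (fun _ : Fin n => Fin n → ℂ) ℂ :=
    { toMultilinearMap := detRowAlternating.toMultilinearMap
      cont := Continuous.matrix_det continuous_id }
  let B : E → Fin n → Fin n → ℂ := fun y i j => A y i j
  have hd : HasFDerivAt d ((d.linearDeriv (B x)).restrictScalars ℝ) (B x) :=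
    (d.hasFDerivAt (B x)).restrictScalars ℝ
  have hA' : HasFDerivAt B
      (ContinuousLinearMap.pi fun i => ContinuousLinearMap.pi fun j =>
        fderiv ℝ (fun y => A y i j) x) x :=
    hasFDerivAt_pi.2 fun i => hasFDerivAt_pi.2 fun j => (hA i j).hasFDerivAt
  have h : HasFDerivAt (fun y => d (B y)) _ x := hd.comp x hA'
  change fderiv ℝ (fun y => d (B y)) x v = _
  rw [h.fderiv]
  simp only [ContinuousLinearMap.comp_apply, ContinuousLinearMap.coe_restrictScalars',
    ContinuousMultilinearMap.linearDeriv_apply]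
  exact Finset.sum_congr rfl fun i _ => det_updateRow_eq_sum_adjugate (A x) i _

lemma contDiffAt_det {k : ℕ∞ω} (hA : ∀ i j, ContDiffAt ℝ k (fun y => A y i j) x) :
    ContDiffAt ℝ k (fun y => (A y).det) x := by
  simp only [det_apply']
  exact ContDiffAt.sum fun σ _ => contDiffAt_const.mul (contDiffAt_prod fun i _ => hA _ _)

lemma contDiffAt_adjugate {k : ℕ∞ω} (hA : ∀ i j, ContDiffAt ℝ k (fun y => A y i j) x)
    (i j : Fin n) : ContDiffAt ℝ k (fun y => (A y).adjugate i j) x := by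
  simp only [adjugate_apply]
  refine contDiffAt_det fun a b => ?_
  by_cases h : a = j
  · subst h; simp only [updateRow_self]; exact contDiffAt_const
  · simp only [updateRow_ne h]; exact hA a b

end MatrixCalculus

/-! ### Complex Hessians and holomorphic maps -/

section Hessian

variable {n : ℕ} {f : (Fin n → ℂ) → ℂ} {z : Fin n → ℂ}

/-- The complex Hessian `(∂²f/∂z^α∂z̄^β)` at `z`. -/
noncomputable def complexHessian (f : (Fin n → ℂ) → ℂ) (z : Fin n → ℂ) : Matrix (Fin n) (Fin n) ℂ :=
  of fun α β => dz α (dzbar β f) z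

lemma contDiffAt_complexHessian {m k : ℕ∞ω} (hf : ContDiffAt ℝ k f z) (hm : m + 1 + 1 ≤ k)
    (α β : Fin n) : ContDiffAt ℝ m (fun z => complexHessian f z α β) z :=
  contDiffAt_dz (contDiffAt_dzbar hf hm β) le_rfl α

lemma dz_det {A : (Fin n → ℂ) → Matrix (Fin n) (Fin n) ℂ}
    (hA : ∀ i j, DifferentiableAt ℝ (fun y => A y i j) z) (α : Fin n) :
    dz α (fun y => (A y).det) z =
      ∑ i, ∑ j, (A z).adjugate j i * dz α (fun y => A y i j) z := by
  simp only [dz, fderiv_det hA, Finset.mul_sum, ← Finset.sum_sub_distrib, Finset.sum_div]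
  refine Finset.sum_congr rfl fun i _ => Finset.sum_congr rfl fun j _ => ?_
  ring

/-- The rows of the adjugate of a complex Hessian are divergence free; this is the coordinate
form of the closedness of `(∂∂̄f)^(n-1)`. -/
lemma sum_dz_adjugate_complexHessian (hf : ContDiffAt ℝ 3 f z)
    (hdet : (complexHessian f z).det ≠ 0) (β : Fin n) :
    ∑ α, dz α (fun z => (complexHessian f z).adjugate β α) z = 0 := by
  have hH : ∀ i j, ContDiffAt ℝ 1 (fun y => complexHessian f y i j) z := fun i j =>
    contDiffAt_complexHessian hf (by norm_num) i j
  have hHd : ∀ i j, DifferentiableAt ℝ (fun y => complexHessian f y i j) z := fun i j =>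
    (hH i j).differentiableAt one_ne_zero
  have hPd : ∀ i j, DifferentiableAt ℝ (fun y => (complexHessian f y).adjugate i j) z :=
    fun i j => (contDiffAt_adjugate hH i j).differentiableAt one_ne_zero
  set A := complexHessian f z with hA
  let X : Fin n → Matrix (Fin n) (Fin n) ℂ := fun α =>
    of fun i j => dz α (fun y => complexHessian f y i j) z
  let Y : Fin n → Matrix (Fin n) (Fin n) ℂ := fun α =>
    of fun i j => dz α (fun y => (complexHessian f y).adjugate i j) z
  let d : Fin n → ℂ := fun α => ∑ i, ∑ j, A.adjugate j i * X α i j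
  have hsymm : ∀ α i j, X α i j = X i α j := fun α i j =>
    dz_dz_comm (contDiffAt_dzbar hf (by norm_num) j) α i
  -- Differentiate `adj(A) * A = det A • 1`.
  have hY : ∀ α, Y α * A + A.adjugate * X α = d α • (1 : Matrix (Fin n) (Fin n) ℂ) := by
    intro α
    ext i j
    have h1 : dz α (fun y => ((complexHessian f y).adjugate * complexHessian f y) i j) z =
        dz α (fun y => ((complexHessian f y).det • (1 : Matrix (Fin n) (Fin n) ℂ)) i j) z := by
      simp only [adjugate_mul]
    simp only [mul_apply, Matrix.smul_apply, smul_eq_mul] at h1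
    rw [dz_sum _ (fun k _ => (hPd i k).fun_mul (hHd k j)),
      dz_mul ((contDiffAt_det hH).differentiableAt one_ne_zero) (differentiableAt_const _),
      dz_const, mul_zero, zero_add, dz_det hHd] at h1
    rw [Matrix.add_apply, mul_apply, mul_apply, Matrix.smul_apply, smul_eq_mul, ← Finset.sum_add_distrib]
    refine Eq.trans ?_ h1
    refine Finset.sum_congr rfl fun k _ => ?_
    rw [dz_mul (hPd i k) (hHd k j), add_comm]
    rfl
  -- Multiplying by `adj(A)` on the right isolates `Y α`.
  have hY2 : ∀ α, A.det • Y α = d α • A.adjugate - A.adjugate * X α * A.adjugate := by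
    intro α
    have h := congrArg (· * A.adjugate) (hY α)
    simp only [add_mul, Matrix.mul_assoc, mul_adjugate, smul_mul, Matrix.one_mul] at h
    rw [← h, Matrix.mul_smul, Matrix.mul_one, Matrix.mul_assoc, add_sub_cancel_right]
  refine (mul_eq_zero.1 ?_).resolve_left hdet
  have h3 : ∀ α, A.det * Y α β α = ∑ i, ∑ j, A.adjugate j i * X α i j * A.adjugate β α -
      ∑ i, ∑ j, A.adjugate β i * X α i j * A.adjugate j α := by
    intro α
    have h := congrFun (congrFun (hY2 α) β) α
    simp only [Matrix.smul_apply, Matrix.sub_apply, smul_eq_mul, mul_apply, Finset.sum_mul, d] at h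
    rw [h]
    congr 1
    exact Finset.sum_comm
  change A.det * ∑ α, Y α β α = 0
  rw [Finset.mul_sum]
  simp only [h3, Finset.sum_sub_distrib]
  rw [sub_eq_zero, Finset.sum_comm]
  refine Finset.sum_congr rfl fun i _ => Finset.sum_congr rfl fun α _ =>
    Finset.sum_congr rfl fun j _ => ?_
  -- The two triple sums agree after exchanging `α` and the row index of `X`.
  rw [hsymm α i j]
  ring

lemma isHermitian_complexHessian (hf : ContDiffAt ℝ 2 f z) (hreal : ∀ z, conj (f z) = f z) :
    (complexHessian f z).IsHermitian := by
  ext α β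
  rw [conjTranspose_apply]
  change conj (dz β (dzbar α f) z) = dz α (dzbar β f) z
  rw [conj_dz, dz_dzbar_comm hf]
  congr 1
  funext y
  rw [conj_dzbar]
  simp only [hreal]

lemma dzbar_eq_conj_dz (hreal : ∀ z, conj (f z) = f z) (α : Fin n) :
    dzbar α f z = conj (dz α f z) := by
  rw [conj_dz]; simp only [hreal]

/-- The complex Jacobian matrix `(∂w^γ/∂z^α)`, with row index `γ`. -/
noncomputable def complexJacobian (w : (Fin n → ℂ) → Fin n → ℂ) (z : Fin n → ℂ) :
    Matrix (Fin n) (Fin n) ℂ :=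
  of fun γ α => fderiv ℂ w z (Pi.single α 1) γ

lemma dz_component {w : (Fin n → ℂ) → Fin n → ℂ} (hw : DifferentiableAt ℂ w z) (α γ : Fin n) :
    dz α (fun z => w z γ) z = complexJacobian w z γ α ∧ dzbar α (fun z => w z γ) z = 0 := by
  have hp : fderiv ℝ (fun v : Fin n → ℂ => v γ) (w z) =
      ContinuousLinearMap.proj (R := ℝ) (φ := fun _ : Fin n => ℂ) γ :=
    (ContinuousLinearMap.proj (R := ℝ) (φ := fun _ : Fin n => ℂ) γ).fderiv
  have hd : DifferentiableAt ℝ (fun v : Fin n → ℂ => v γ) (w z) := by fun_prop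
  have h (v : Fin n → ℂ) : fderiv ℝ (fun z => w z γ) z v = fderiv ℂ w z v γ := by
    rw [fderiv_comp_holomorphic hd hw, hp]; rfl
  simp only [dz, dzbar, h, fderiv_single_I, complexJacobian, of_apply]
  constructor <;> linear_combination (norm := (ring_nf; try simp))
    ((1 : ℂ) / 2 * fderiv ℂ w z (Pi.single α 1) γ) * I_sq

/-- The entries of the Jacobian matrix of a holomorphic map are annihilated by `∂/∂z̄`. Only real
smoothness and the Cauchy-Riemann equations are used. -/
lemma dzbar_complexJacobian {w : (Fin n → ℂ) → Fin n → ℂ}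
    (hw : ∀ᶠ y in 𝓝 z, DifferentiableAt ℂ w y) (hw2 : ContDiffAt ℝ 2 w z) (α β γ : Fin n) :
    dzbar α (fun y => complexJacobian w y γ β) z = 0 := by
  have hc : ContDiffAt ℝ 2 (fun y => w y γ) z := contDiffAt_pi.1 hw2 γ
  rw [dzbar_congr (g := dz β fun y => w y γ)
    (hw.mono fun y hy => ((dz_component hy β γ).1).symm), ← dz_dzbar_comm hc,
    dz_congr (g := fun _ => 0) (hw.mono fun y hy => (dz_component hy α γ).2), dz_const]

lemma differentiableAt_complexJacobian {w : (Fin n → ℂ) → Fin n → ℂ}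
    (hw : ∀ᶠ y in 𝓝 z, DifferentiableAt ℂ w y) (hw2 : ContDiffAt ℝ 2 w z) (γ β : Fin n) :
    DifferentiableAt ℝ (fun y => complexJacobian w y γ β) z := by
  have hc : ContDiffAt ℝ 2 (fun y => w y γ) z := contDiffAt_pi.1 hw2 γ
  have h : ContDiffAt ℝ 1 (dz β fun y => w y γ) z := contDiffAt_dz hc (by norm_num) β
  exact (h.differentiableAt one_ne_zero).congr_of_eventuallyEq
    (hw.mono fun y hy => ((dz_component hy β γ).1).symm)

/-- The complex Hessian transforms as a Hermitian form under holomorphic maps. -/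
lemma complexHessian_comp {g : (Fin n → ℂ) → ℂ} {w : (Fin n → ℂ) → Fin n → ℂ}
    (hg : ContDiffAt ℝ 2 g (w z)) (hw : ∀ᶠ y in 𝓝 z, DifferentiableAt ℂ w y)
    (hw2 : ContDiffAt ℝ 2 w z) :
    complexHessian (fun y => g (w y)) z =
      (complexJacobian w z)ᵀ * complexHessian g (w z) * (complexJacobian w z).map conj := by
  have hwz : DifferentiableAt ℂ w z := hw.self_of_nhds
  have hgd : ∀ᶠ y in 𝓝 z, DifferentiableAt ℝ g (w y) :=
    hwz.continuousAt.eventually ((hg.eventually (by simp)).mono fun y hy =>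
      hy.differentiableAt two_ne_zero)
  have hg1 (γ : Fin n) : DifferentiableAt ℝ (dzbar γ g) (w z) :=
    (contDiffAt_dzbar (m := 1) hg (by norm_num) γ).differentiableAt one_ne_zero
  have hJ (γ β : Fin n) : DifferentiableAt ℝ (fun y => conj (complexJacobian w y γ β)) z :=
    conjCLE.differentiableAt.comp z (differentiableAt_complexJacobian hw hw2 γ β)
  have hgw (γ : Fin n) : DifferentiableAt ℝ (fun y => dzbar γ g (w y)) z :=
    (hg1 γ).comp z (hw2.differentiableAt two_ne_zero)
  ext α β
  change dz α (dzbar β fun y => g (w y)) z = _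
  rw [dz_congr (g := fun y => ∑ γ, dzbar γ g (w y) * conj (complexJacobian w y γ β))
    ((hw.and hgd).mono fun y hy => dzbar_comp hy.2 hy.1 β),
    dz_sum _ fun γ _ => (hgw γ).fun_mul (hJ γ β)]
  simp only [mul_apply, map_apply]
  refine Finset.sum_congr rfl fun γ _ => ?_
  rw [dz_mul (hgw γ) (hJ γ β), dz_comp (hg1 γ) hwz]
  have h0 : dz α (fun y => conj (complexJacobian w y γ β)) z = 0 := by
    rw [← conj_dzbar, dzbar_complexJacobian hw hw2, map_zero]
  rw [h0, mul_zero, zero_add]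
  congr 1
  refine Finset.sum_congr rfl fun δ _ => ?_
  rw [transpose_apply, mul_comm]
  rfl

end Hessian

/-! ### Functions on the local model -/

section Plaque

variable {n : ℕ}

/-- The derivative `∂f/∂z^α` along the plaques of a function of `(z, t)`. -/
noncomputable def plaqueDz (α : Fin n) (f : Model n → ℂ) (x : Model n) : ℂ :=
  dz α (fun z => f (z, x.2)) x.1

/-- The derivative `∂f/∂z̄^α` along the plaques of a function of `(z, t)`. -/
noncomputable def plaqueDzbar (α : Fin n) (f : Model n → ℂ) (x : Model n) : ℂ :=
  dzbar α (fun z => f (z, x.2)) x.1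

variable {f : Model n → ℂ} {x : Model n}

lemma contDiffAt_slice {G : Type*} [NormedAddCommGroup G] [NormedSpace ℝ G] {f : Model n → G}
    {k : ℕ∞ω} (hf : ContDiffAt ℝ k f x) : ContDiffAt ℝ k (fun z => f (z, x.2)) x.1 :=
  ContDiffAt.comp x.1 (g := f) (f := fun z => (z, x.2)) hf
    (contDiffAt_id.prodMk contDiffAt_const)

lemma differentiableAt_slice (hf : DifferentiableAt ℝ f x) :
    DifferentiableAt ℝ (fun z => f (z, x.2)) x.1 :=
  DifferentiableAt.comp x.1 (g := f) (f := fun z => (z, x.2)) hf (by fun_prop)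

lemma fderiv_slice {G : Type*} [NormedAddCommGroup G] [NormedSpace ℝ G] {f : Model n → G}
    (hf : DifferentiableAt ℝ f x) (v : Fin n → ℂ) :
    fderiv ℝ (fun z => f (z, x.2)) x.1 v = fderiv ℝ f x (v, 0) := by
  have h1 : HasFDerivAt (fun z : Fin n → ℂ => (z, x.2))
      ((ContinuousLinearMap.id ℝ (Fin n → ℂ)).prod 0) x.1 :=
    (hasFDerivAt_id _).prodMk (hasFDerivAt_const _ _)
  have h2 : HasFDerivAt f (fderiv ℝ f x) (x.1, x.2) := hf.hasFDerivAt
  have h : HasFDerivAt (fun z => f (z, x.2)) _ x.1 := h2.comp x.1 h1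
  rw [h.fderiv]
  rfl

lemma plaqueDz_eq (hf : DifferentiableAt ℝ f x) (α : Fin n) :
    plaqueDz α f x =
      (fderiv ℝ f x (Pi.single α 1, 0) - I * fderiv ℝ f x (Pi.single α I, 0)) / 2 := by
  rw [plaqueDz, dz, fderiv_slice hf, fderiv_slice hf]

lemma plaqueDzbar_eq (hf : DifferentiableAt ℝ f x) (α : Fin n) :
    plaqueDzbar α f x =
      (fderiv ℝ f x (Pi.single α 1, 0) + I * fderiv ℝ f x (Pi.single α I, 0)) / 2 := by
  rw [plaqueDzbar, dzbar, fderiv_slice hf, fderiv_slice hf]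

lemma eventually_differentiableAt {m : ℕ} (hf : ContDiffAt ℝ (m + 1 : ℕ) f x) :
    ∀ᶠ y in 𝓝 x, DifferentiableAt ℝ f y :=
  (hf.eventually (by simp)).mono fun _ hy => hy.differentiableAt (by simp)

lemma contDiffAt_plaqueDz {m : ℕ} (hf : ContDiffAt ℝ (m + 1 : ℕ) f x) (α : Fin n) :
    ContDiffAt ℝ m (plaqueDz α f) x := by
  have h := hf.fderiv_right (m := m) (by push_cast; rfl)
  have h1 := h.clm_apply (contDiffAt_const (c := ((Pi.single α 1, 0) : Model n)))
  have h2 := h.clm_apply (contDiffAt_const (c := ((Pi.single α I, 0) : Model n)))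
  exact ((h1.sub (contDiffAt_const.mul h2)).div_const 2).congr_of_eventuallyEq
    ((eventually_differentiableAt hf).mono fun y hy => plaqueDz_eq hy α)

lemma contDiffAt_plaqueDzbar {m : ℕ} (hf : ContDiffAt ℝ (m + 1 : ℕ) f x) (α : Fin n) :
    ContDiffAt ℝ m (plaqueDzbar α f) x := by
  have h := hf.fderiv_right (m := m) (by push_cast; rfl)
  have h1 := h.clm_apply (contDiffAt_const (c := ((Pi.single α 1, 0) : Model n)))
  have h2 := h.clm_apply (contDiffAt_const (c := ((Pi.single α I, 0) : Model n)))
  exact ((h1.add (contDiffAt_const.mul h2)).div_const 2).congr_of_eventuallyEq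
    ((eventually_differentiableAt hf).mono fun y hy => plaqueDzbar_eq hy α)

/-- The real determinant of a map `(v, s) ↦ (J v + s b, s c)` with `J` complex linear is
`|det J|² c`. -/
lemma det_blockTriangular (L : Model n →L[ℝ] Model n) (J : (Fin n → ℂ) →ₗ[ℂ] (Fin n → ℂ))
    (h : ∀ v, L (v, 0) = (J v, 0)) :
    L.det = normSq (LinearMap.det J) * (L (0, 1)).2 := by
  let b := Module.finBasis ℝ (Fin n → ℂ)
  let o := Module.Basis.singleton Unit ℝ
  have hm : LinearMap.toMatrix (b.prod o) (b.prod o) (L : Model n →ₗ[ℝ] Model n) =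
      fromBlocks (LinearMap.toMatrix b b (J.restrictScalars ℝ))
        (of fun i _ => b.repr (L (0, 1)).1 i) 0 (of fun _ _ => (L (0, 1)).2) := by
    ext i j
    rcases i with i | i <;> rcases j with j | j <;>
      simp [LinearMap.toMatrix_apply, h, o]
  rw [ContinuousLinearMap.det, ← LinearMap.det_toMatrix (b.prod o), hm, det_fromBlocks_zero₂₁,
    LinearMap.det_toMatrix, LinearMap.det_restrictScalars, Algebra.norm_complex_apply]
  simp

lemma det_complexJacobian (w : (Fin n → ℂ) → Fin n → ℂ) (z : Fin n → ℂ) :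
    LinearMap.det (fderiv ℂ w z : (Fin n → ℂ) →ₗ[ℂ] (Fin n → ℂ)) = (complexJacobian w z).det := by
  rw [← LinearMap.det_toMatrix']
  congr 1

end Plaque

/-! ### Changes of foliated charts -/

section Charts

variable {n : ℕ} {M : Type*} [TopologicalSpace M] {k : ℕ∞ω} {F : Structure n k M}
  {e e' : OpenPartialHomeomorph M (Model n)} {x : Model n}

lemma isOpen_box : IsOpen (box n) := by
  have h1 : IsOpen {x : Model n | ∀ j, ‖x.1 j‖ < 1} := by
    simp only [ofPred_forall]
    exact isOpen_iInter_of_finite fun j => isOpen_lt (by fun_prop) (by fun_prop)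
  have h2 : IsOpen {x : Model n | x.2 ∈ Ioo (-1 : ℝ) 1} := isOpen_Ioo.preimage continuous_snd
  exact h1.inter h2

lemma Structure.contDiffAt_transition (he : e ∈ F.atlas) (he' : e' ∈ F.atlas)
    (hx : x ∈ (transition e e').source) : ContDiffAt ℝ k (transition e e') x :=
  (F.contDiffOn e he e' he').contDiffAt ((transition e e').open_source.mem_nhds hx)

lemma Structure.mem_box_of_mem_source (he : e ∈ F.atlas) (hx : x ∈ (transition e e').source) :
    x ∈ box n := by
  rw [← F.target_eq e he]
  rw [OpenPartialHomeomorph.trans_source] at hx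
  exact hx.1

lemma Structure.transition_mem_box (he' : e' ∈ F.atlas)
    (hx : x ∈ (transition e e').source) : transition e e' x ∈ box n := by
  rw [← F.target_eq e' he']
  have := (transition e e').map_source hx
  rw [OpenPartialHomeomorph.trans_target] at this
  exact this.1

lemma tendsto_slice (x : Model n) : Tendsto (fun z => (z, x.2)) (𝓝 x.1) (𝓝 x) :=
  (continuous_id.prodMk continuous_const).tendsto' _ _ rfl

/-- The leaf component of a coordinate change, along the plaque through `x`. -/
noncomputable def leafMap (e e' : OpenPartialHomeomorph M (Model n)) (x : Model n)
    (z : Fin n → ℂ) : Fin n → ℂ :=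
  (transition e e' (z, x.2)).1

/-- The derivative `dt'/dt` of the transverse component of a coordinate change. -/
noncomputable def transverseDeriv (e e' : OpenPartialHomeomorph M (Model n)) (x : Model n) : ℝ :=
  deriv (fun s : ℝ => (transition e e' (x.1, s)).2) x.2

lemma Structure.eventually_transition_slice (he : e ∈ F.atlas) (he' : e' ∈ F.atlas)
    (hx : x ∈ (transition e e').source) :
    ∀ᶠ z in 𝓝 x.1, transition e e' (z, x.2) = (leafMap e e' x z, (transition e e' x).2) := by
  filter_upwards [(tendsto_slice x).eventually (F.transverse e he e' he' x hx)] with z hz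
  exact Prod.ext rfl (hz rfl)

lemma Structure.eventually_mem_source (hx : x ∈ (transition e e').source) :
    ∀ᶠ z in 𝓝 x.1, (z, x.2) ∈ (transition e e').source :=
  (tendsto_slice x).eventually ((transition e e').open_source.mem_nhds hx)

lemma Structure.eventually_differentiableAt_leafMap (he : e ∈ F.atlas) (he' : e' ∈ F.atlas)
    (hx : x ∈ (transition e e').source) :
    ∀ᶠ z in 𝓝 x.1, DifferentiableAt ℂ (leafMap e e' x) z :=
  (eventually_mem_source hx).mono fun _ hz => F.holomorphic e he e' he' _ hz

lemma Structure.contDiffAt_leafMap (he : e ∈ F.atlas) (he' : e' ∈ F.atlas)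
    (hx : x ∈ (transition e e').source) : ContDiffAt ℝ k (leafMap e e' x) x.1 :=
  (contDiffAt_slice (F.contDiffAt_transition he he' hx)).fst

/-- `dt'/dt` is locally constant along plaques. The constancy of `t'` on a plaque is only given
near each point, with no uniformity in `t`; connectedness of balls makes it uniform. -/
lemma Structure.eventually_transverseDeriv_eq (hk : k ≠ 0) (he : e ∈ F.atlas) (he' : e' ∈ F.atlas)
    (hx : x ∈ (transition e e').source) :
    ∀ᶠ z in 𝓝 x.1, transverseDeriv e e' (z, x.2) = transverseDeriv e e' x := by
  obtain ⟨ε, hε, hb⟩ := Metric.isOpen_iff.1 (transition e e').open_source x hx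
  rw [show x = (x.1, x.2) from rfl, ← ball_prod_same] at hb
  have hconst : ∀ z ∈ Metric.ball x.1 ε, ∀ s ∈ Metric.ball x.2 ε,
      (transition e e' (z, s)).2 = (transition e e' (x.1, s)).2 := by
    intro z hz s hs
    have hmem : ∀ y ∈ Metric.ball x.1 ε, (y, s) ∈ (transition e e').source :=
      fun y hy => hb ⟨hy, hs⟩
    refine IsOpen.is_const_of_fderiv_eq_zero (𝕜 := ℝ)
      (f := fun y => (transition e e' (y, s)).2) Metric.isOpen_ball
      (convex_ball x.1 ε).isPreconnected ?_ ?_ hz (Metric.mem_ball_self hε)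
    · intro y hy
      exact ((contDiffAt_slice (F.contDiffAt_transition he he' (hmem y hy))).snd.differentiableAt
        hk).differentiableWithinAt
    · intro y hy
      have : (fun y => (transition e e' (y, s)).2) =ᶠ[𝓝 y]
          fun _ => (transition e e' (y, s)).2 := by
        filter_upwards [(tendsto_slice (y, s)).eventually
          (F.transverse e he e' he' _ (hmem y hy))] with z hz
        exact hz rfl
      rw [this.fderiv_eq]
      simp
  filter_upwards [Metric.ball_mem_nhds x.1 hε] with z hz
  refine Filter.EventuallyEq.deriv_eq ?_
  filter_upwards [Metric.ball_mem_nhds x.2 hε] with s hs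
  exact hconst z hz s hs

lemma Structure.det_fderiv_transition (hk : k ≠ 0) (he : e ∈ F.atlas) (he' : e' ∈ F.atlas)
    (hx : x ∈ (transition e e').source) :
    (fderiv ℝ (transition e e') x).det =
      normSq (complexJacobian (leafMap e e' x) x.1).det * transverseDeriv e e' x := by
  have hd : DifferentiableAt ℝ (transition e e') x :=
    (F.contDiffAt_transition he he' hx).differentiableAt hk
  have hw := (F.eventually_differentiableAt_leafMap he he' hx).self_of_nhds
  rw [det_blockTriangular _ (fderiv ℂ (leafMap e e' x) x.1 : (Fin n → ℂ) →ₗ[ℂ] (Fin n → ℂ)),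
    det_complexJacobian]
  · congr 1
    have h1 : HasFDerivAt (transition e e') (fderiv ℝ (transition e e') x) (x.1, x.2) :=
      hd.hasFDerivAt
    have h2 : HasDerivAt (fun s : ℝ => (x.1, s)) ((0, 1) : Model n) x.2 :=
      (hasDerivAt_const _ _).prodMk (hasDerivAt_id _)
    have h3 := h1.comp_hasDerivAt x.2 h2
    have h4 : HasDerivAt (fun s : ℝ => (transition e e' (x.1, s)).2)
        (fderiv ℝ (transition e e') x (0, 1)).2 x.2 := by
      simpa using HasFDerivAt.hasDerivAt (HasDerivAt.hasFDerivAt h3).snd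
    exact h4.deriv.symm
  · intro v
    rw [← fderiv_slice hd v]
    have h1 : HasFDerivAt (fun z => (leafMap e e' x z, (transition e e' x).2))
        (((fderiv ℂ (leafMap e e' x) x.1).restrictScalars ℝ).prod
          (0 : (Fin n → ℂ) →L[ℝ] ℝ)) x.1 :=
      (hw.hasFDerivAt.restrictScalars ℝ).prodMk (hasFDerivAt_const _ _)
    have h2 : (fun z => transition e e' (z, x.2)) =ᶠ[𝓝 x.1]
        fun z => (leafMap e e' x z, (transition e e' x).2) :=
      F.eventually_transition_slice he he' hx
    rw [h2.fderiv_eq, h1.fderiv]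
    rfl

end Charts

/-! ### The vector density of a transverse measure and its divergence -/

section Flux

variable {n : ℕ} {M : Type*} [TopologicalSpace M] {F : Structure n 4 M}
  {e e' : OpenPartialHomeomorph M (Model n)} {x : Model n}

/-- The function `u = -log h` of `(z, t)` in the chart `e`. -/
noncomputable def TransverseMeasure.potential (μ : TransverseMeasure F 3)
    (e : OpenPartialHomeomorph M (Model n)) (x : Model n) : ℂ :=
  -(Real.log (μ.density e x) : ℂ)

/-- The matrix `(∂²u/∂z^α∂z̄^β)` of the form `iΘ_μ` in the chart `e`. -/
noncomputable def TransverseMeasure.hessian (μ : TransverseMeasure F 3)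
    (e : OpenPartialHomeomorph M (Model n)) (x : Model n) : Matrix (Fin n) (Fin n) ℂ :=
  complexHessian (fun z => μ.potential e (z, x.2)) x.1

/-- The row vector `(∂u/∂z̄^β)` in the chart `e`. -/
noncomputable def TransverseMeasure.gradBar (μ : TransverseMeasure F 3)
    (e : OpenPartialHomeomorph M (Model n)) (x : Model n) : Fin n → ℂ :=
  fun β => plaqueDzbar β (μ.potential e) x

/-- The components `V^α = h ∑ (∂u/∂z̄^β) adj(Θ)^{βα}` of a vector density of type `(1, 0)` tangent
to the leaves. It represents the form `h |dt| ∧ ∂̄u ∧ (∂∂̄u)^(n-1)`, up to a constant. -/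
noncomputable def TransverseMeasure.vectorDensity (μ : TransverseMeasure F 3)
    (e : OpenPartialHomeomorph M (Model n)) (α : Fin n) (x : Model n) : ℂ :=
  μ.density e x * (μ.gradBar e x ᵥ* (μ.hessian e x).adjugate) α

/-- The density `∑ V^α ∂f/∂z^α`, the derivative of `f` along the vector density `V`. -/
noncomputable def TransverseMeasure.fluxDensity (μ : TransverseMeasure F 3)
    (e : OpenPartialHomeomorph M (Model n)) (f : Model n → ℂ) (x : Model n) : ℂ :=
  ∑ α, μ.vectorDensity e α x * plaqueDz α f x

/-- The divergence `h (n det Θ - ∑ (∂u/∂z̄^β) adj(Θ)^{βα} (∂u/∂z^α))` of `V`. -/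
noncomputable def TransverseMeasure.divergence (μ : TransverseMeasure F 3)
    (e : OpenPartialHomeomorph M (Model n)) (x : Model n) : ℂ :=
  μ.density e x * (n * (μ.hessian e x).det -
    μ.gradBar e x ᵥ* (μ.hessian e x).adjugate ⬝ᵥ fun α => plaqueDz α (μ.potential e) x)

variable {μ : TransverseMeasure F 3}

lemma TransverseMeasure.contDiffAt_density (he : e ∈ F.atlas) (hx : x ∈ box n) :
    ContDiffAt ℝ 3 (μ.density e) x :=
  (μ.contDiffOn e he).contDiffAt (isOpen_box.mem_nhds hx)

lemma TransverseMeasure.contDiffAt_potential (he : e ∈ F.atlas) (hx : x ∈ box n) :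
    ContDiffAt ℝ 3 (μ.potential e) x :=
  (ofRealCLM.contDiff.contDiffAt.comp x
    ((μ.contDiffAt_density he hx).log (μ.pos e he x hx).ne')).neg

lemma TransverseMeasure.contDiffAt_hessian (he : e ∈ F.atlas) (hx : x ∈ box n) (i j : Fin n) :
    ContDiffAt ℝ 1 (fun y => μ.hessian e y i j) x :=
  contDiffAt_plaqueDz (m := 1)
    (contDiffAt_plaqueDzbar (m := 2) (μ.contDiffAt_potential he hx) j) i

lemma TransverseMeasure.contDiffAt_gradBar (he : e ∈ F.atlas) (hx : x ∈ box n) (j : Fin n) :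
    ContDiffAt ℝ 2 (fun y => μ.gradBar e y j) x :=
  contDiffAt_plaqueDzbar (m := 2) (μ.contDiffAt_potential he hx) j

lemma TransverseMeasure.contDiffAt_vectorDensity (he : e ∈ F.atlas) (hx : x ∈ box n)
    (α : Fin n) : ContDiffAt ℝ 1 (μ.vectorDensity e α) x := by
  have h : ContDiffAt ℝ 1 (fun y => (μ.density e y : ℂ)) x :=
    ofRealCLM.contDiff.contDiffAt.comp x ((μ.contDiffAt_density he hx).of_le (by norm_num))
  have hsum : ContDiffAt ℝ 1
      (fun y => ∑ β, μ.gradBar e y β * (μ.hessian e y).adjugate β α) x :=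
    ContDiffAt.sum fun β _ => ((μ.contDiffAt_gradBar he hx β).of_le (by norm_num)).mul
    (contDiffAt_adjugate (fun i j => μ.contDiffAt_hessian he hx i j) β α)
  exact h.mul hsum

lemma TransverseMeasure.continuousAt_divergence (he : e ∈ F.atlas) (hx : x ∈ box n) :
    ContinuousAt (μ.divergence e) x := by
  have h : ContinuousAt (fun y => (μ.density e y : ℂ)) x :=
    continuous_ofReal.continuousAt.comp (μ.contDiffAt_density he hx).continuousAt
  have hP (β α : Fin n) : ContinuousAt (fun y => (μ.hessian e y).adjugate β α) x :=
    (contDiffAt_adjugate (fun i j => μ.contDiffAt_hessian he hx i j) β α).continuousAt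
  have hdet : ContinuousAt (fun y => (μ.hessian e y).det) x :=
    (contDiffAt_det fun i j => μ.contDiffAt_hessian he hx i j).continuousAt
  have hsum : ContinuousAt (fun y => ∑ α,
      (∑ β, μ.gradBar e y β * (μ.hessian e y).adjugate β α) * plaqueDz α (μ.potential e) y) x :=
    tendsto_finsetSum _ fun α _ => ContinuousAt.mul
      (tendsto_finsetSum _ fun β _ => (μ.contDiffAt_gradBar he hx β).continuousAt.mul (hP β α))
      (contDiffAt_plaqueDz (m := 2) (μ.contDiffAt_potential he hx) α).continuousAt
  exact h.mul ((continuousAt_const.mul hdet).sub hsum)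

lemma TransverseMeasure.conj_potential (μ : TransverseMeasure F 3)
    (e : OpenPartialHomeomorph M (Model n)) (x : Model n) :
    conj (μ.potential e x) = μ.potential e x := by
  simp [potential]

lemma TransverseMeasure.isHermitian_hessian (he : e ∈ F.atlas) (hx : x ∈ box n) :
    (μ.hessian e x).IsHermitian :=
  isHermitian_complexHessian
    ((contDiffAt_slice (μ.contDiffAt_potential he hx)).of_le (by norm_num))
    fun _ => μ.conj_potential e _

lemma TransverseMeasure.eventually_potential_eq (he : e ∈ F.atlas) (he' : e' ∈ F.atlas)
    (hx : x ∈ (transition e e').source) :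
    ∀ᶠ z in 𝓝 x.1, μ.potential e (z, x.2) =
      μ.potential e' (leafMap e e' x z, (transition e e' x).2) -
        Real.log |transverseDeriv e e' x| := by
  filter_upwards [F.eventually_transition_slice he he' hx,
    F.eventually_transverseDeriv_eq (by norm_num) he he' hx,
    Structure.eventually_mem_source hx] with z h1 h2 h3
  have hpos := μ.pos e he _ (F.mem_box_of_mem_source he h3)
  have hpos' := μ.pos e' he' _ (F.transition_mem_box he' h3)
  have hc := μ.compatible e he e' he' _ h3
  change _ = _ * |transverseDeriv e e' (z, x.2)| at hc
  rw [h2] at hc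
  have h0 : |transverseDeriv e e' x| ≠ 0 := by
    rintro h0; rw [h0, mul_zero] at hc; exact hpos.ne' hc
  rw [potential, potential, ← h1, hc, Real.log_mul hpos'.ne' h0]
  push_cast
  ring

lemma TransverseMeasure.contDiffAt_potential_leafMap (he' : e' ∈ F.atlas)
    (hx : x ∈ (transition e e').source) :
    ContDiffAt ℝ 3 (fun z => μ.potential e' (z, (transition e e' x).2)) (leafMap e e' x x.1) :=
  contDiffAt_slice (μ.contDiffAt_potential he' (F.transition_mem_box he' hx))

lemma TransverseMeasure.hessian_transition (he : e ∈ F.atlas) (he' : e' ∈ F.atlas)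
    (hx : x ∈ (transition e e').source) :
    μ.hessian e x = (complexJacobian (leafMap e e' x) x.1)ᵀ * μ.hessian e' (transition e e' x) *
      (complexJacobian (leafMap e e' x) x.1).map conj := by
  refine Eq.trans ?_ (complexHessian_comp
    (g := fun z => μ.potential e' (z, (transition e e' x).2))
    ((μ.contDiffAt_potential_leafMap he' hx).of_le (by norm_num))
    (F.eventually_differentiableAt_leafMap he he' hx)
    ((F.contDiffAt_leafMap he he' hx).of_le (by norm_num)))
  ext α β
  refine dz_congr ?_ α
  filter_upwards [(μ.eventually_potential_eq he he' hx).eventually_nhds] with y hy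
  rw [dzbar_congr hy β, dzbar_sub_const]

lemma TransverseMeasure.gradBar_transition (he : e ∈ F.atlas) (he' : e' ∈ F.atlas)
    (hx : x ∈ (transition e e').source) :
    μ.gradBar e x =
      μ.gradBar e' (transition e e' x) ᵥ* (complexJacobian (leafMap e e' x) x.1).map conj := by
  funext β
  refine Eq.trans ?_ (dzbar_comp
    (g := fun z => μ.potential e' (z, (transition e e' x).2))
    ((μ.contDiffAt_potential_leafMap he' hx).differentiableAt (by norm_num))
    (F.eventually_differentiableAt_leafMap he he' hx).self_of_nhds β)
  rw [gradBar, plaqueDzbar, dzbar_congr (μ.eventually_potential_eq he he' hx) β, dzbar_sub_const]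

/-- `adj(JᵀΘK)` contracted with `b K` and `Jᵀ a` is `det J det K` times `adj(Θ)` contracted with
`b` and `a`. -/
lemma vecMul_adjugate_dotProduct (J K B : Matrix (Fin n) (Fin n) ℂ) (a b : Fin n → ℂ) :
    (b ᵥ* K) ᵥ* (Jᵀ * B * K).adjugate ⬝ᵥ (Jᵀ *ᵥ a) =
      J.det * K.det * (b ᵥ* B.adjugate ⬝ᵥ a) := by
  have h : K * (Jᵀ * B * K).adjugate * Jᵀ = (J.det * K.det) • B.adjugate := by
    rw [adjugate_mul_distrib, adjugate_mul_distrib, Matrix.mul_assoc, Matrix.mul_assoc,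
      Matrix.mul_assoc, adjugate_mul, ← Matrix.mul_assoc, mul_adjugate, det_transpose]
    simp [smul_smul]
  rw [dotProduct_mulVec, vecMul_vecMul, vecMul_vecMul, ← Matrix.mul_assoc, h, vecMul_smul,
    smul_dotProduct, smul_eq_mul]

/-- The flux density of a function is a density on `M`: in two charts, its expressions differ by
the absolute value of the real Jacobian determinant. -/
lemma TransverseMeasure.fluxDensity_transition (he : e ∈ F.atlas) (he' : e' ∈ F.atlas)
    (hx : x ∈ (transition e e').source) {f f' : Model n → ℂ}
    (hf' : DifferentiableAt ℝ f' (transition e e' x))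
    (hf : ∀ᶠ y in 𝓝 x, f y = f' (transition e e' y)) :
    μ.fluxDensity e f x =
      |(fderiv ℝ (transition e e') x).det| * μ.fluxDensity e' f' (transition e e' x) := by
  set J := complexJacobian (leafMap e e' x) x.1 with hJ
  have hfz : (fun z => f (z, x.2)) =ᶠ[𝓝 x.1]
      fun z => f' (leafMap e e' x z, (transition e e' x).2) := by
    filter_upwards [(tendsto_slice x).eventually hf,
      F.eventually_transition_slice he he' hx] with z h1 h2
    rw [h1, h2]
  have hf's : DifferentiableAt ℝ (fun z => f' (z, (transition e e' x).2))
      (leafMap e e' x x.1) := differentiableAt_slice hf'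
  have ha : (fun α => plaqueDz α f x) =
      Jᵀ *ᵥ fun α => plaqueDz α f' (transition e e' x) := by
    funext α
    rw [plaqueDz, dz_congr hfz, dz_comp (g := fun z => f' (z, (transition e e' x).2)) hf's
      (F.eventually_differentiableAt_leafMap he he' hx).self_of_nhds]
    exact Finset.sum_congr rfl fun γ _ => mul_comm _ _
  have hdet : (J.map conj).det = conj J.det := by
    rw [← RingHom.mapMatrix_apply, ← RingHom.map_det]
  have key : ∀ (c : OpenPartialHomeomorph M (Model n)) (g : Model n → ℂ) (y : Model n),
      μ.fluxDensity c g y = μ.density c y *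
        (μ.gradBar c y ᵥ* (μ.hessian c y).adjugate ⬝ᵥ fun α => plaqueDz α g y) := by
    intro c g y
    simp only [fluxDensity, vectorDensity, dotProduct, Finset.mul_sum, mul_assoc]
  rw [key, key, ha, μ.hessian_transition he he' hx, μ.gradBar_transition he he' hx, ← hJ,
    vecMul_adjugate_dotProduct, hdet, mul_conj, F.det_fderiv_transition (by norm_num) he he' hx,
    μ.compatible e he e' he' x hx, abs_mul, abs_of_nonneg (normSq_nonneg _), ← hJ]
  change ((_ * |transverseDeriv e e' x| : ℝ) : ℂ) * _ = _
  push_cast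
  ring

lemma TransverseMeasure.dz_density (he : e ∈ F.atlas) (hx : x ∈ box n) (α : Fin n) :
    dz α (fun z => (μ.density e (z, x.2) : ℂ)) x.1 =
      -μ.density e x * plaqueDz α (μ.potential e) x := by
  have hu : DifferentiableAt ℝ (fun z => μ.potential e (z, x.2)) x.1 :=
    (contDiffAt_slice (μ.contDiffAt_potential he hx)).differentiableAt (by norm_num)
  have heq : ∀ y ∈ box n, (μ.density e y : ℂ) = cexp (-μ.potential e y) := by
    intro y hy
    rw [potential, neg_neg, ← ofReal_exp, Real.exp_log (μ.pos e he y hy)]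
  have hev : (fun z => (μ.density e (z, x.2) : ℂ)) =ᶠ[𝓝 x.1]
      fun z => cexp (-μ.potential e (z, x.2)) :=
    (tendsto_slice x).eventually (Filter.mem_of_superset (isOpen_box.mem_nhds hx) heq)
  have h := (hu.hasFDerivAt.fun_neg).cexp
  rw [dz_congr hev, heq x hx, plaqueDz, dz, h.fderiv, dz]
  simp only [_root_.smul_apply, _root_.neg_apply, smul_eq_mul]
  ring

/-- The product rule for `V`; the divergence of `V` has no term with third derivatives of `u`,
because the rows of the adjugate of the Hessian are divergence free. -/
lemma TransverseMeasure.sum_plaqueDz_mul_vectorDensity (he : e ∈ F.atlas) (hx : x ∈ box n)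
    (hdet : (μ.hessian e x).det ≠ 0) {f : Model n → ℂ} (hf : DifferentiableAt ℝ f x) :
    ∑ α, plaqueDz α (fun y => f y * μ.vectorDensity e α y) x =
      f x * μ.divergence e x + μ.fluxDensity e f x := by
  have hfs : DifferentiableAt ℝ (fun z => f (z, x.2)) x.1 := differentiableAt_slice hf
  have hu := contDiffAt_slice (μ.contDiffAt_potential he hx)
  have hh : DifferentiableAt ℝ (fun z => (μ.density e (z, x.2) : ℂ)) x.1 :=
    (ofRealCLM.differentiableAt).comp x.1
      ((contDiffAt_slice (μ.contDiffAt_density he hx)).differentiableAt (by norm_num))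
  have hb (β : Fin n) : DifferentiableAt ℝ (fun z => μ.gradBar e (z, x.2) β) x.1 :=
    (contDiffAt_slice (μ.contDiffAt_gradBar he hx β)).differentiableAt (by norm_num)
  have hP (β α : Fin n) :
      DifferentiableAt ℝ (fun z => (μ.hessian e (z, x.2)).adjugate β α) x.1 :=
    (contDiffAt_slice (contDiffAt_adjugate (fun i j => μ.contDiffAt_hessian he hx i j) β α)
      ).differentiableAt (by norm_num)
  have hV (α : Fin n) : DifferentiableAt ℝ (fun z => μ.vectorDensity e α (z, x.2)) x.1 :=
    (contDiffAt_slice (μ.contDiffAt_vectorDensity he hx α)).differentiableAt (by norm_num)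
  have hdV (α : Fin n) : dz α (fun z => μ.vectorDensity e α (z, x.2)) x.1 =
      μ.density e x * ∑ β, (μ.gradBar e x β *
          dz α (fun z => (μ.hessian e (z, x.2)).adjugate β α) x.1 +
        μ.hessian e x α β * (μ.hessian e x).adjugate β α) -
      μ.density e x * ((μ.gradBar e x ᵥ* (μ.hessian e x).adjugate) α *
        plaqueDz α (μ.potential e) x) := by
    change dz α (fun z => (μ.density e (z, x.2) : ℂ) *
      ∑ β, μ.gradBar e (z, x.2) β * (μ.hessian e (z, x.2)).adjugate β α) x.1 = _
    rw [dz_mul hh (DifferentiableAt.fun_sum fun β _ => (hb β).fun_mul (hP β α)),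
      dz_sum _ fun β _ => (hb β).fun_mul (hP β α), μ.dz_density he hx, sub_eq_add_neg]
    congr 1
    · congr 1
      exact Finset.sum_congr rfl fun β _ => dz_mul (hb β) (hP β α) α
    · simp only [vecMul, dotProduct]
      ring
  have h1 : ∑ α, ∑ β, μ.gradBar e x β *
      dz α (fun z => (μ.hessian e (z, x.2)).adjugate β α) x.1 = 0 := by
    rw [Finset.sum_comm]
    refine Finset.sum_eq_zero fun β _ => ?_
    rw [← Finset.mul_sum]
    exact mul_eq_zero_of_right _ (sum_dz_adjugate_complexHessian hu hdet β)
  have h2 : ∑ α, ∑ β, μ.hessian e x α β * (μ.hessian e x).adjugate β α =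
      n * (μ.hessian e x).det := by
    have : ∀ α, ∑ β, μ.hessian e x α β * (μ.hessian e x).adjugate β α =
        (μ.hessian e x).det := by
      intro α
      rw [← mul_apply, mul_adjugate]
      simp
    simp [this]
  have h3 : ∑ α, dz α (fun z => μ.vectorDensity e α (z, x.2)) x.1 = μ.divergence e x := by
    simp only [hdV, Finset.sum_sub_distrib, ← Finset.mul_sum, Finset.sum_add_distrib, h1, h2,
      zero_add, divergence, mul_sub]
    rfl
  rw [← h3, fluxDensity, Finset.mul_sum, ← Finset.sum_add_distrib]
  refine Finset.sum_congr rfl fun α _ => ?_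
  rw [plaqueDz, dz_mul hfs (hV α), mul_comm (dz α _ _)]
  rfl

end Flux

/-! ### Positivity of the divergence -/

section Positivity

open scoped ComplexOrder

variable {n : ℕ} {M : Type*} [TopologicalSpace M] {F : Structure n 4 M}
  {e : OpenPartialHomeomorph M (Model n)} {x : Model n} {μ : TransverseMeasure F 3}

lemma TransverseMeasure.formTheta_star (y : Fin n → ℂ) :
    μ.formTheta e x (star y) = (star y ⬝ᵥ μ.hessian e x *ᵥ y).re := by
  simp only [dotProduct, mulVec, Finset.mul_sum]
  refine congrArg re (Finset.sum_congr rfl fun α _ => Finset.sum_congr rfl fun β _ => ?_)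
  change μ.hessian e x α β * conj (y α) * conj (conj (y β)) =
    conj (y α) * (μ.hessian e x α β * y β)
  rw [conj_conj]
  ring

lemma TransverseMeasure.gradBar_eq_star :
    μ.gradBar e x = star fun α => plaqueDz α (μ.potential e) x :=
  funext fun _ => dzbar_eq_conj_dz (fun _ => μ.conj_potential e _) _

lemma TransverseMeasure.formA_star (y : Fin n → ℂ) :
    μ.formA e x (star y) = normSq (μ.gradBar e x ⬝ᵥ y) := by
  have h1 (α : Fin n) : dz α (μ.logDensity e x.2) x.1 = -plaqueDz α (μ.potential e) x := by
    rw [plaqueDz, ← dz_neg]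
    simp only [potential, neg_neg]
    rfl
  have h2 (α : Fin n) : dzbar α (μ.logDensity e x.2) x.1 = -μ.gradBar e x α := by
    rw [gradBar, plaqueDzbar, ← dzbar_neg]
    simp only [potential, neg_neg]
    rfl
  have h3 (α : Fin n) : plaqueDz α (μ.potential e) x = conj (μ.gradBar e x α) := by
    rw [gradBar_eq_star]; simp
  rw [← ofReal_re (normSq _), ← mul_conj, dotProduct, map_sum, Finset.sum_mul_sum,
    Finset.sum_comm, formA]
  refine congrArg re (Finset.sum_congr rfl fun α _ => Finset.sum_congr rfl fun β _ => ?_)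
  rw [h1, h2, h3, map_mul, Pi.star_apply, Pi.star_apply, star_def, conj_conj]
  ring

/-- If `iA_μ < n iΘ_μ`, then `iΘ_μ` is positive definite and the divergence of `V` is positive:
the vector `ζ` dual to `∂u` with respect to `iΘ_μ` shows that the squared norm of `∂u` with
respect to `iΘ_μ` is less than `n`. -/
lemma TransverseMeasure.divergence_pos (hn : 1 ≤ n) (he : e ∈ F.atlas) (hx : x ∈ box n)
    (h : ∀ ζ : Fin n → ℂ, ζ ≠ 0 → μ.formA e x ζ < n * μ.formTheta e x ζ) :
    (μ.hessian e x).det ≠ 0 ∧ 0 < (μ.divergence e x).re := by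
  have hn' : (0 : ℝ) < n := by exact_mod_cast hn
  have hH := μ.isHermitian_hessian he hx
  have hlt : ∀ y : Fin n → ℂ, y ≠ 0 →
      normSq (μ.gradBar e x ⬝ᵥ y) < n * (star y ⬝ᵥ μ.hessian e x *ᵥ y).re := by
    intro y hy
    rw [← formTheta_star, ← formA_star]
    exact h _ (star_ne_zero.2 hy)
  have him : ∀ y : Fin n → ℂ, (star y ⬝ᵥ μ.hessian e x *ᵥ y).im = 0 :=
    fun y => hH.im_star_dotProduct_mulVec_self y
  have hpd : (μ.hessian e x).PosDef := by
    refine PosDef.of_dotProduct_mulVec_pos hH fun y hy => ?_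
    rw [Complex.lt_def]
    exact ⟨pos_of_mul_pos_right ((normSq_nonneg _).trans_lt (hlt y hy)) hn'.le, (him y).symm⟩
  have hdet := hpd.det_pos
  refine ⟨hdet.ne', ?_⟩
  set a := fun α => plaqueDz α (μ.potential e) x with ha
  -- The vector `v = y / det Θ` solves `Θ v = ∂u`; the inequality is applied to the conjugate of `y`.
  set y := (μ.hessian e x).adjugate *ᵥ a with hy
  obtain ⟨d, hd, hdd⟩ : ∃ d : ℝ, 0 < d ∧ (μ.hessian e x).det = d :=
    ⟨_, (Complex.lt_def.1 hdet).1, Complex.ext rfl (Complex.lt_def.1 hdet).2.symm⟩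
  have hq : μ.gradBar e x ᵥ* (μ.hessian e x).adjugate ⬝ᵥ a = μ.gradBar e x ⬝ᵥ y := by
    rw [hy, dotProduct_mulVec]
  have hΘ : star y ⬝ᵥ μ.hessian e x *ᵥ y = d * conj (μ.gradBar e x ⬝ᵥ y) := by
    rw [hy, mulVec_mulVec, mul_adjugate, smul_mulVec, one_mulVec, ← hy, dotProduct_smul, hdd,
      gradBar_eq_star, ← star_def, star_dotProduct, ← ha, smul_eq_mul]
  have hre : (μ.divergence e x).re = μ.density e x * (n * d - (μ.gradBar e x ⬝ᵥ y).re) := by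
    rw [divergence, ← ha, hq, hdd, re_ofReal_mul]
    simp
  rw [hre]
  refine mul_pos (μ.pos e he x hx) (sub_pos.2 ?_)
  by_cases hy0 : y = 0
  · rw [hy0, dotProduct_zero, zero_re]; positivity
  · have h1 := hlt y hy0
    have h2 := him y
    rw [hΘ] at h1 h2
    rw [im_ofReal_mul, conj_im] at h2
    have h3 : (μ.gradBar e x ⬝ᵥ y).im = 0 := by
      rcases mul_eq_zero.1 h2 with h | h
      · exact absurd h hd.ne'
      · linarith
    rw [re_ofReal_mul, conj_re, normSq_apply, h3] at h1
    nlinarith [mul_pos hn' hd]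

end Positivity

/-! ### Integration by parts in a chart -/

section Integration

open MeasureTheory

variable {n : ℕ} {f : Model n → ℂ} {K : Set (Model n)}

instance isAddHaarMeasure_volume : (volume : Measure (Model n)).IsAddHaarMeasure :=
  Measure.prod.instIsAddHaarMeasure volume volume

lemma plaqueDz_congr {g : Model n → ℂ} {x : Model n} (h : f =ᶠ[𝓝 x] g) (α : Fin n) :
    plaqueDz α f x = plaqueDz α g x :=
  dz_congr ((tendsto_slice x).eventually h) α

lemma plaqueDz_eq_zero {x : Model n} (h : ∀ᶠ y in 𝓝 x, f y = 0) (α : Fin n) :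
    plaqueDz α f x = 0 :=
  (plaqueDz_congr h α).trans (dz_const α 0)

lemma continuousAt_plaqueDz {x : Model n} (hf : ContDiffAt ℝ 1 f x) (α : Fin n) :
    ContinuousAt (plaqueDz α f) x :=
  (contDiffAt_plaqueDz (m := 0) (by exact_mod_cast hf) α).continuousAt

lemma integral_fderiv_eq_zero (hf : ContDiff ℝ 1 f) (hc : HasCompactSupport f) (v : Model n) :
    ∫ x, fderiv ℝ f x v = 0 := by
  have hint : Integrable (fun x => fderiv ℝ f x v) :=
    ((hf.continuous_fderiv one_ne_zero).clm_apply continuous_const).integrable_of_hasCompactSupport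
      (hc.fderiv_apply ℝ v)
  -- Integration by parts against the constant function `1`.
  have h := integral_mul_fderiv_eq_neg_fderiv_mul_of_integrable (μ := volume) (f := fun _ => 1)
    (g := f) (v := v) (by simp) (by simpa using hint)
    (by simpa using hf.continuous.integrable_of_hasCompactSupport hc) (by simp)
    (fun x _ => (hf.differentiable one_ne_zero) x)
  simpa using h

lemma integrableOn_box (hK : IsCompact K) (hKb : K ⊆ box n) (hf : ∀ x ∈ box n, ContinuousAt f x)
    (h0 : ∀ x ∈ box n \ K, f x = 0) : IntegrableOn f (box n) :=
  (ContinuousOn.integrableOn_compact hK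
    fun x hx => (hf x (hKb hx)).continuousWithinAt).of_forall_sdiff_eq_zero
    isOpen_box.measurableSet h0

/-- There is no boundary term: the function vanishes off a compact subset of the box. -/
lemma setIntegral_box_plaqueDz_eq_zero (hK : IsCompact K) (hKb : K ⊆ box n)
    (hf : ∀ x ∈ box n, ContDiffAt ℝ 1 f x) (h0 : ∀ x ∈ box n \ K, f x = 0) (α : Fin n) :
    ∫ x in box n, plaqueDz α f x = 0 := by
  set g := K.indicator f with hg
  have hgf : ∀ x ∈ box n, g x = f x := by
    intro x hx
    by_cases hxK : x ∈ K
    · exact indicator_of_mem hxK f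
    · rw [hg, indicator_of_notMem hxK, h0 x ⟨hx, hxK⟩]
  have hg0 : ∀ x ∉ K, g =ᶠ[𝓝 x] fun _ => 0 := fun x hx =>
    Filter.mem_of_superset (hK.isClosed.isOpen_compl.mem_nhds hx)
      fun y hy => indicator_of_notMem hy f
  have hgfev : ∀ x ∈ box n, g =ᶠ[𝓝 x] f := fun x hx =>
    Filter.mem_of_superset (isOpen_box.mem_nhds hx) hgf
  have hgc : ContDiff ℝ 1 g := contDiff_iff_contDiffAt.2 fun x => by
    by_cases hx : x ∈ box n
    · exact (hf x hx).congr_of_eventuallyEq (hgfev x hx)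
    · exact contDiffAt_const.congr_of_eventuallyEq (hg0 x fun h => hx (hKb h))
  have hgs : HasCompactSupport g :=
    HasCompactSupport.intro hK fun x hx => indicator_of_notMem hx f
  have hint (v : Model n) : Integrable fun x => fderiv ℝ g x v :=
    ((hgc.continuous_fderiv one_ne_zero).clm_apply
      continuous_const).integrable_of_hasCompactSupport (hgs.fderiv_apply ℝ v)
  rw [setIntegral_congr_fun isOpen_box.measurableSet
    fun x hx => (plaqueDz_congr (hgfev x hx) α).symm,
    setIntegral_eq_integral_of_forall_compl_eq_zero
      fun x hx => plaqueDz_eq_zero (hg0 x fun h => hx (hKb h)) α]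
  simp_rw [fun x => plaqueDz_eq (hgc.differentiable one_ne_zero x) α]
  rw [integral_div, integral_sub (hint _) ((hint _).const_mul I), integral_const_mul,
    integral_fderiv_eq_zero hgc hgs, integral_fderiv_eq_zero hgc hgs]
  simp

end Integration

/-! ### Partitions of unity -/

section Partition

variable {n : ℕ} {M : Type*} [TopologicalSpace M] {F : Structure n 4 M}

/-- The expression in the chart `e` of a real function on `M`. -/
noncomputable def inChart (e : OpenPartialHomeomorph M (Model n)) (φ : M → ℝ) (x : Model n) : ℂ :=
  φ (e.symm x)

/-- A real function on `M` that is `C¹` in all foliated charts. -/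
def IsC1 (F : Structure n 4 M) (φ : M → ℝ) : Prop :=
  ∀ e ∈ F.atlas, ∀ x ∈ box n, ContDiffAt ℝ 1 (fun y => φ (e.symm y)) x

lemma IsC1.contDiffAt_inChart {φ : M → ℝ} (hφ : IsC1 F φ)
    {e : OpenPartialHomeomorph M (Model n)} (he : e ∈ F.atlas) {x : Model n} (hx : x ∈ box n) :
    ContDiffAt ℝ 1 (inChart e φ) x :=
  ofRealCLM.contDiff.contDiffAt.comp x (hφ e he x hx)

lemma Structure.continuousAt_symm {e : OpenPartialHomeomorph M (Model n)} (he : e ∈ F.atlas)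
    {x : Model n} (hx : x ∈ box n) : ContinuousAt e.symm x :=
  e.continuousAt_symm (by rwa [F.target_eq e he])

lemma Structure.symm_mem_source {e : OpenPartialHomeomorph M (Model n)} (he : e ∈ F.atlas)
    {x : Model n} (hx : x ∈ box n) : e.symm x ∈ e.source :=
  e.map_target (by rwa [F.target_eq e he])

lemma Structure.mem_transition_source {e e' : OpenPartialHomeomorph M (Model n)}
    (he : e ∈ F.atlas) {x : Model n} :
    x ∈ (transition e e').source ↔ x ∈ box n ∧ e.symm x ∈ e'.source := by
  rw [OpenPartialHomeomorph.trans_source, OpenPartialHomeomorph.symm_source, F.target_eq e he]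
  rfl

lemma eventually_notMem_of_isCompact [T2Space M] {e : OpenPartialHomeomorph M (Model n)}
    (he : e ∈ F.atlas) {x : Model n} (hx : x ∈ box n) {C : Set M} (hC : IsCompact C)
    (hxC : e.symm x ∉ C) : ∀ᶠ y in 𝓝 x, e.symm y ∉ C :=
  (F.continuousAt_symm he hx).eventually (hC.isClosed.isOpen_compl.mem_nhds hxC)

/-- A cutoff function in a foliated chart, extended by zero. The extension is continuous because
its support is compact, hence closed, as `M` is Hausdorff. -/
lemma exists_bump [T2Space M] (F : Structure n 4 M) (p : M) :
    ∃ e ∈ F.atlas, ∃ C ⊆ e.source, IsCompact C ∧ ∃ φ : M → ℝ, (∀ m, 0 ≤ φ m) ∧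
      (∀ m ∉ C, φ m = 0) ∧ 0 < φ p ∧ Continuous φ ∧ IsC1 F φ := by
  classical
  obtain ⟨e, he, hp⟩ := F.cover p
  have hpb : e p ∈ box n := by
    rw [← F.target_eq e he]; exact e.map_source hp
  obtain ⟨b, hbs, hbc, hb, hbr, hbp⟩ :=
    exists_contDiff_tsupport_subset (n := 4) (isOpen_box.mem_nhds hpb)
  have hbt : tsupport b ⊆ e.target := by rwa [F.target_eq e he]
  let φ : M → ℝ := fun m => if m ∈ e.source then b (e m) else 0
  let C : Set M := e.symm '' tsupport b
  have hCs : C ⊆ e.source := by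
    rintro _ ⟨x, hx, rfl⟩
    exact e.map_target (hbt hx)
  have hC : IsCompact C := hbc.isCompact.image_of_continuousOn (e.continuousOn_symm.mono hbt)
  have hφC : ∀ m ∉ C, φ m = 0 := by
    intro m hm
    by_cases hms : m ∈ e.source
    · simp only [φ, if_pos hms]
      exact image_eq_zero_of_notMem_tsupport fun h => hm ⟨e m, h, e.left_inv hms⟩
    · simp only [φ, if_neg hms]
  refine ⟨e, he, C, hCs, hC, φ, fun m => ?_, hφC, ?_, ?_, ?_⟩
  · by_cases hms : m ∈ e.source
    · simp only [φ, if_pos hms]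
      exact (hbr (mem_range_self _)).1
    · simp only [φ, if_neg hms, le_refl]
  · simp only [φ, if_pos hp, hbp, zero_lt_one]
  · refine continuous_iff_continuousAt.2 fun m => ?_
    by_cases hms : m ∈ e.source
    · refine (hb.continuous.continuousAt.comp (e.continuousAt hms)).congr ?_
      filter_upwards [e.open_source.mem_nhds hms] with y hy
      simp only [φ, if_pos hy, Function.comp]
    · refine (continuousAt_const (y := (0 : ℝ))).congr ?_
      filter_upwards [hC.isClosed.isOpen_compl.mem_nhds fun h => hms (hCs h)] with y hy
      exact (hφC y hy).symm
  · intro e' he' x hx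
    by_cases hxs : e'.symm x ∈ e.source
    · have hxT : x ∈ (transition e' e).source := (F.mem_transition_source he').2 ⟨hx, hxs⟩
      have h : ContDiffAt ℝ 1 (fun y => b (transition e' e y)) x :=
        (hb.contDiffAt.of_le (by norm_num)).comp x
          ((F.contDiffAt_transition he' he hxT).of_le (by norm_num))
      refine h.congr_of_eventuallyEq ?_
      filter_upwards [(transition e' e).open_source.mem_nhds hxT] with y hy
      simp only [φ, if_pos ((F.mem_transition_source he').1 hy).2]
      rfl
    · refine (contDiffAt_const (c := (0 : ℝ))).congr_of_eventuallyEq ?_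
      filter_upwards [eventually_notMem_of_isCompact he' hx hC fun h => hxs (hCs h)] with y hy
      exact hφC _ hy

/-- A compact Levi-flat manifold has a finite `C¹` partition of unity subordinate to foliated
charts. It is indexed by points of `M`; the functions outside of the finite index set `s` do not
enter the sum. -/
lemma exists_partition [T2Space M] [CompactSpace M] (F : Structure n 4 M) :
    ∃ (s : Finset M) (c : M → OpenPartialHomeomorph M (Model n)) (C : M → Set M)
      (χ : M → M → ℝ), (∀ i, c i ∈ F.atlas) ∧ (∀ i, C i ⊆ (c i).source) ∧
      (∀ i, IsCompact (C i)) ∧ (∀ i m, 0 ≤ χ i m) ∧ (∀ i, ∀ m ∉ C i, χ i m = 0) ∧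
      (∀ i, Continuous (χ i)) ∧ (∀ i, IsC1 F (χ i)) ∧ ∀ m, ∑ i ∈ s, χ i m = 1 := by
  choose c hc C hCs hC φ hφ0 hφC hφp hφc hφ1 using exists_bump F
  obtain ⟨s, hs⟩ := isCompact_univ.elim_finite_subcover (fun i => {m | 0 < φ i m})
    (fun i => isOpen_lt continuous_const (hφc i)) fun m _ => mem_iUnion.2 ⟨m, hφp m⟩
  let S : M → ℝ := fun m => ∑ i ∈ s, φ i m
  have hS : ∀ m, 0 < S m := by
    intro m
    obtain ⟨i, hi, him⟩ := mem_iUnion₂.1 (hs (mem_univ m))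
    exact Finset.sum_pos' (fun j _ => hφ0 j m) ⟨i, hi, him⟩
  have hSc : Continuous S := continuous_finsetSum _ fun i _ => hφc i
  refine ⟨s, c, C, fun i m => φ i m / S m, hc, hCs, hC,
    fun i m => div_nonneg (hφ0 i m) (hS m).le, fun i m hm => ?_, fun i => ?_,
    fun i e he x hx => ?_, fun m => ?_⟩
  · simp only [hφC i m hm, zero_div]
  · exact (hφc i).div hSc fun m => (hS m).ne'
  · exact (hφ1 i e he x hx).fun_div (ContDiffAt.sum fun j _ => hφ1 j e he x hx) (hS _).ne'
  · rw [← Finset.sum_div]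
    exact div_self (hS m).ne'

end Partition

/-! ### Integration over the manifold -/

section Stokes

open MeasureTheory

variable {n : ℕ} {M : Type*} [TopologicalSpace M] {F : Structure n 4 M}
  {e e' : OpenPartialHomeomorph M (Model n)} {μ : TransverseMeasure F 3}

lemma isCompact_image_chart {C : Set M} (hC : IsCompact C) (hCs : C ⊆ e.source) :
    IsCompact (e '' C) :=
  hC.image_of_continuousOn (e.continuousOn.mono hCs)

lemma Structure.image_chart_subset_box (he : e ∈ F.atlas) {C : Set M} (hCs : C ⊆ e.source) :
    e '' C ⊆ box n := by
  rintro _ ⟨m, hm, rfl⟩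
  rw [← F.target_eq e he]
  exact e.map_source (hCs hm)

lemma Structure.symm_notMem_of_notMem_image (he : e ∈ F.atlas) {C : Set M} {x : Model n}
    (hx : x ∈ box n \ e '' C) : e.symm x ∉ C := fun h =>
  hx.2 ⟨_, h, e.right_inv (by rw [F.target_eq e he]; exact hx.1)⟩

lemma TransverseMeasure.continuousAt_fluxDensity (he : e ∈ F.atlas) {f : Model n → ℂ}
    {x : Model n} (hx : x ∈ box n) (hf : ContDiffAt ℝ 1 f x) :
    ContinuousAt (μ.fluxDensity e f) x :=
  tendsto_finsetSum _ fun α _ =>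
    (μ.contDiffAt_vectorDensity he hx α).continuousAt.mul (continuousAt_plaqueDz hf α)

lemma TransverseMeasure.fluxDensity_eq_zero {f : Model n → ℂ} {x : Model n}
    (h : ∀ᶠ y in 𝓝 x, f y = 0) : μ.fluxDensity e f x = 0 :=
  Finset.sum_eq_zero fun α _ => by rw [plaqueDz_eq_zero h, mul_zero]

lemma inChart_eventually_eq_zero [T2Space M] (he : e ∈ F.atlas) {C : Set M} (hC : IsCompact C)
    {φ : M → ℝ} (hφ : ∀ m ∉ C, φ m = 0) {x : Model n} (hx : x ∈ box n) (hxC : e.symm x ∉ C) :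
    ∀ᶠ y in 𝓝 x, inChart e φ y = 0 :=
  (eventually_notMem_of_isCompact he hx hC hxC).mono fun y hy => by
    rw [inChart, hφ _ hy, ofReal_zero]

lemma TransverseMeasure.integrableOn_fluxDensity [T2Space M] (he : e ∈ F.atlas) {C : Set M}
    (hC : IsCompact C) (hCs : C ⊆ e.source) {φ : M → ℝ} (hφ : ∀ m ∉ C, φ m = 0)
    (hφ1 : IsC1 F φ) {g : M → ℝ} (hg : Continuous g) :
    IntegrableOn (fun x => inChart e g x * μ.fluxDensity e (inChart e φ) x) (box n) := by
  refine integrableOn_box (isCompact_image_chart hC hCs) (F.image_chart_subset_box he hCs)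
    (fun x hx => ?_) fun x hx => ?_
  · exact (continuous_ofReal.continuousAt.comp
      (hg.continuousAt.comp (F.continuousAt_symm he hx))).mul
      (μ.continuousAt_fluxDensity he hx (hφ1.contDiffAt_inChart he hx))
  · rw [μ.fluxDensity_eq_zero (inChart_eventually_eq_zero he hC hφ hx.1
      (F.symm_notMem_of_notMem_image he hx)), mul_zero]

/-- The integral of `g` against the flux density of `φ` does not depend on the chart, if `φ` has
compact support in the one and `g` in the other. -/
lemma TransverseMeasure.setIntegral_fluxDensity_transition [T2Space M] (he : e ∈ F.atlas)
    (he' : e' ∈ F.atlas) {C : Set M} (hC : IsCompact C) (hCs : C ⊆ e.source) {φ : M → ℝ}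
    (hφ : ∀ m ∉ C, φ m = 0) (hφ1 : IsC1 F φ) {g : M → ℝ} (hg : ∀ m ∉ e'.source, g m = 0) :
    ∫ x in box n, inChart e g x * μ.fluxDensity e (inChart e φ) x =
      ∫ x in box n, inChart e' g x * μ.fluxDensity e' (inChart e' φ) x := by
  set T := transition e e' with hT
  have hsource : T.source ⊆ box n := fun x hx => F.mem_box_of_mem_source he hx
  have htarget : T.target ⊆ box n := fun x hx => by
    rw [← T.right_inv hx]
    exact F.transition_mem_box he' (T.map_target hx)
  have hchart : ∀ (ψ : M → ℝ), ∀ x ∈ T.source, inChart e ψ x = inChart e' ψ (T x) := by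
    intro ψ x hx
    have : e'.symm (T x) = e.symm x := e'.left_inv ((F.mem_transition_source he).1 hx).2
    rw [inChart, inChart, this]
  rw [setIntegral_eq_of_subset_of_forall_sdiff_eq_zero isOpen_box.measurableSet hsource,
    setIntegral_eq_of_subset_of_forall_sdiff_eq_zero isOpen_box.measurableSet htarget,
    ← T.image_source_eq_target,
    integral_image_eq_integral_abs_det_fderiv_smul volume T.open_source.measurableSet
      (fun x hx => (((F.contDiffAt_transition he he' hx).differentiableAt
        (by norm_num)).hasFDerivAt).hasFDerivWithinAt) T.injOn]
  · refine setIntegral_congr_fun T.open_source.measurableSet fun x hx => ?_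
    have h1 := μ.fluxDensity_transition he he' hx
      ((hφ1.contDiffAt_inChart he' (F.transition_mem_box he' hx)).differentiableAt one_ne_zero)
      (Filter.mem_of_superset (T.open_source.mem_nhds hx) (hchart φ))
    simp only [h1, hchart g x hx, real_smul]
    ring
  · -- On the rest of `box n` seen in `e'`, the function `φ` vanishes locally.
    intro y hy
    have hyC : e'.symm y ∉ C := by
      intro h
      refine hy.2 ?_
      rw [OpenPartialHomeomorph.trans_target, OpenPartialHomeomorph.symm_target]
      exact ⟨by rw [F.target_eq e' he']; exact hy.1, hCs h⟩
    rw [μ.fluxDensity_eq_zero (inChart_eventually_eq_zero he' hC hφ hy.1 hyC), mul_zero]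
  · -- On the rest of `box n` seen in `e`, the function `g` vanishes.
    intro x hx
    have : e.symm x ∉ e'.source := fun h =>
      hx.2 ((F.mem_transition_source he).2 ⟨hx.1, h⟩)
    rw [inChart, hg _ this, ofReal_zero, zero_mul]

/-- Stokes' theorem in a chart. -/
lemma TransverseMeasure.setIntegral_divergence [T2Space M] (he : e ∈ F.atlas)
    (hdet : ∀ x ∈ box n, (μ.hessian e x).det ≠ 0) {C : Set M}
    (hC : IsCompact C) (hCs : C ⊆ e.source) {φ : M → ℝ} (hφ : ∀ m ∉ C, φ m = 0)
    (hφ1 : IsC1 F φ) :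
    IntegrableOn (fun x => inChart e φ x * μ.divergence e x) (box n) ∧
    ∫ x in box n, inChart e φ x * μ.divergence e x =
      -∫ x in box n, μ.fluxDensity e (inChart e φ) x := by
  have hK := isCompact_image_chart hC hCs
  have hKb := F.image_chart_subset_box he hCs
  have hev : ∀ x ∈ box n \ e '' C, ∀ᶠ y in 𝓝 x, inChart e φ y = 0 := fun x hx =>
    inChart_eventually_eq_zero he hC hφ hx.1 (F.symm_notMem_of_notMem_image he hx)
  have hc1 : ∀ x ∈ box n, ContDiffAt ℝ 1 (inChart e φ) x := fun x hx =>
    hφ1.contDiffAt_inChart he hx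
  have hprod : ∀ α, ∀ x ∈ box n,
      ContDiffAt ℝ 1 (fun y => inChart e φ y * μ.vectorDensity e α y) x := fun α x hx =>
    (hc1 x hx).mul (μ.contDiffAt_vectorDensity he hx α)
  have hint1 : IntegrableOn (fun x => inChart e φ x * μ.divergence e x) (box n) := by
    refine integrableOn_box hK hKb
      (fun x hx => (hc1 x hx).continuousAt.mul (μ.continuousAt_divergence he hx)) fun x hx => ?_
    rw [(hev x hx).self_of_nhds, zero_mul]
  have hint2 : IntegrableOn (μ.fluxDensity e (inChart e φ)) (box n) :=
    integrableOn_box hK hKb (fun x hx => μ.continuousAt_fluxDensity he hx (hc1 x hx))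
      fun x hx => μ.fluxDensity_eq_zero (hev x hx)
  have hint3 : ∀ α, IntegrableOn
      (plaqueDz α fun y => inChart e φ y * μ.vectorDensity e α y) (box n) := fun α =>
    integrableOn_box hK hKb (fun x hx => continuousAt_plaqueDz (hprod α x hx) α)
      fun x hx => plaqueDz_eq_zero ((hev x hx).mono fun y hy => by rw [hy, zero_mul]) α
  have h0 : ∫ x in box n,
      ∑ α, plaqueDz α (fun y => inChart e φ y * μ.vectorDensity e α y) x = 0 := by
    rw [integral_finsetSum _ fun α _ => hint3 α]
    exact Finset.sum_eq_zero fun α _ => setIntegral_box_plaqueDz_eq_zero hK hKb (hprod α)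
      (fun x hx => by rw [(hev x hx).self_of_nhds, zero_mul]) α
  refine ⟨hint1, eq_neg_of_add_eq_zero_left ?_⟩
  rw [← integral_add hint1 hint2, ← h0]
  refine setIntegral_congr_fun isOpen_box.measurableSet fun x hx => ?_
  exact (μ.sum_plaqueDz_mul_vectorDensity he hx (hdet x hx)
    ((hc1 x hx).differentiableAt one_ne_zero)).symm

/-- There is no transverse measure on a non-empty compact Levi-flat manifold for which `iΘ_μ` is
non-degenerate and the divergence of `V` is positive everywhere. -/
lemma TransverseMeasure.false_of_divergence_pos [T2Space M] [CompactSpace M] [Nonempty M]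
    (μ : TransverseMeasure F 3)
    (hdet : ∀ e ∈ F.atlas, ∀ x ∈ box n, (μ.hessian e x).det ≠ 0)
    (hpos : ∀ e ∈ F.atlas, ∀ x ∈ box n, 0 < (μ.divergence e x).re) : False := by
  obtain ⟨s, c, C, χ, hc, hCs, hC, hχ0, hχC, hχc, hχ1, hsum⟩ := exists_partition F
  have hstokes := fun i => μ.setIntegral_divergence (hc i) (hdet _ (hc i)) (hC i) (hCs i)
    (hχC i) (hχ1 i)
  -- In the chart `c j`, the flux densities of the `χ i` add up to that of the constant `1`.
  have hflux0 : ∀ j, ∀ x ∈ box n, ∑ i ∈ s, μ.fluxDensity (c j) (inChart (c j) (χ i)) x = 0 := by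
    intro j x hx
    simp only [fluxDensity]
    rw [Finset.sum_comm]
    refine Finset.sum_eq_zero fun α _ => ?_
    rw [← Finset.mul_sum]
    refine mul_eq_zero_of_right _ ?_
    have h : ∀ i ∈ s, DifferentiableAt ℝ (fun z => inChart (c j) (χ i) (z, x.2)) x.1 :=
      fun i _ => differentiableAt_slice
        (((hχ1 i).contDiffAt_inChart (hc j) hx).differentiableAt one_ne_zero)
    simp only [plaqueDz]
    rw [← dz_sum s h]
    refine (dz_congr (g := fun _ => 1) (Eventually.of_forall fun z => ?_) α).trans (dz_const α 1)
    simp only [inChart, ← ofReal_sum, hsum, ofReal_one]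
  have htotal : ∑ i ∈ s, ∫ x in box n, inChart (c i) (χ i) x * μ.divergence (c i) x = 0 := by
    -- Insert `∑ j, χ j = 1` and compute the `j`-th term in the chart `c j`.
    have hsplit : ∀ i, ∫ x in box n, μ.fluxDensity (c i) (inChart (c i) (χ i)) x =
        ∑ j ∈ s, ∫ x in box n,
          inChart (c j) (χ j) x * μ.fluxDensity (c j) (inChart (c j) (χ i)) x := by
      intro i
      rw [Finset.sum_congr rfl fun j _ =>
        (μ.setIntegral_fluxDensity_transition (hc i) (hc j) (hC i) (hCs i) (hχC i) (hχ1 i)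
          (g := χ j) fun m hm => hχC j m fun h => hm (hCs j h)).symm,
        ← integral_finsetSum _ fun j _ =>
          μ.integrableOn_fluxDensity (hc i) (hC i) (hCs i) (hχC i) (hχ1 i) (hχc j)]
      refine integral_congr_ae (Eventually.of_forall fun x => ?_)
      simp only [← Finset.sum_mul, inChart, ← ofReal_sum, hsum, ofReal_one, one_mul]
    have hint : ∀ i j, IntegrableOn (fun x => inChart (c j) (χ j) x *
        μ.fluxDensity (c j) (inChart (c j) (χ i)) x) (box n) := by
      intro i j
      refine integrableOn_box (isCompact_image_chart (hC j) (hCs j))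
        (F.image_chart_subset_box (hc j) (hCs j)) (fun x hx => ?_) fun x hx => ?_
      · exact ((hχ1 j).contDiffAt_inChart (hc j) hx).continuousAt.mul
          (μ.continuousAt_fluxDensity (hc j) hx ((hχ1 i).contDiffAt_inChart (hc j) hx))
      · rw [inChart, hχC j _ (F.symm_notMem_of_notMem_image (hc j) hx), ofReal_zero, zero_mul]
    simp only [fun i => (hstokes i).2, hsplit, Finset.sum_neg_distrib]
    rw [neg_eq_zero, Finset.sum_comm]
    refine Finset.sum_eq_zero fun j _ => ?_
    rw [← integral_finsetSum _ fun i _ => hint i j]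
    refine (setIntegral_congr_fun (g := fun _ => 0) isOpen_box.measurableSet fun x hx => ?_).trans
      (integral_zero _ _)
    simp only [← Finset.mul_sum, hflux0 j x hx, mul_zero]
  have hre : ∀ i, (∫ x in box n, inChart (c i) (χ i) x * μ.divergence (c i) x).re =
      ∫ x in box n, χ i ((c i).symm x) * (μ.divergence (c i) x).re := by
    intro i
    rw [← reCLM_apply, ← reCLM.integral_comp_comm (hstokes i).1]
    refine integral_congr_ae (Eventually.of_forall fun x => ?_)
    exact re_ofReal_mul _ _
  have hnonneg : ∀ i, ∀ x ∈ box n, 0 ≤ χ i ((c i).symm x) * (μ.divergence (c i) x).re :=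
    fun i x hx => mul_nonneg (hχ0 i _) (hpos _ (hc i) x hx).le
  obtain ⟨m⟩ := ‹Nonempty M›
  obtain ⟨i, hi, him⟩ : ∃ i ∈ s, χ i m ≠ 0 := by
    by_contra! h
    have := hsum m
    rw [Finset.sum_eq_zero h] at this
    exact zero_ne_one this
  have hmC : m ∈ C i := by
    by_contra h
    exact him (hχC i m h)
  have hxb : c i m ∈ box n := F.image_chart_subset_box (hc i) (hCs i) ⟨m, hmC, rfl⟩
  have hipos : 0 < ∫ x in box n, χ i ((c i).symm x) * (μ.divergence (c i) x).re := by
    have hint : IntegrableOn (fun x => χ i ((c i).symm x) * (μ.divergence (c i) x).re) (box n) := by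
      refine (reCLM.integrable_comp (hstokes i).1).congr (Eventually.of_forall fun x => ?_)
      exact re_ofReal_mul _ _
    rw [setIntegral_pos_iff_support_of_nonneg_ae
      ((ae_restrict_iff' isOpen_box.measurableSet).2 (Eventually.of_forall (hnonneg i))) hint]
    have hcont : ContinuousAt (fun x => χ i ((c i).symm x) * (μ.divergence (c i) x).re)
        (c i m) :=
      ((hχc i).continuousAt.comp (F.continuousAt_symm (hc i) hxb)).mul
        (continuous_re.continuousAt.comp (μ.continuousAt_divergence (hc i) hxb))
    have hne : χ i ((c i).symm (c i m)) * (μ.divergence (c i) (c i m)).re ≠ 0 := by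
      rw [(c i).left_inv (hCs i hmC)]
      exact mul_ne_zero him (hpos _ (hc i) _ hxb).ne'
    exact Measure.measure_pos_of_mem_nhds volume
      (Filter.inter_mem (hcont.eventually_ne hne) (isOpen_box.mem_nhds hxb))
  have hsumpos : 0 < ∑ i ∈ s, ∫ x in box n, χ i ((c i).symm x) * (μ.divergence (c i) x).re :=
    Finset.sum_pos' (fun j _ => setIntegral_nonneg isOpen_box.measurableSet (hnonneg j))
      ⟨i, hi, hipos⟩
  have := congrArg re htotal
  rw [re_sum, Finset.sum_congr rfl fun i _ => hre i] at this
  exact hsumpos.ne' this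

end Stokes

end LeviFlat

theorem mainTheorem1 (n : ℕ) (hn : 1 ≤ n)
    {M : Type*} [TopologicalSpace M] [T2Space M] [CompactSpace M] [Nonempty M]
    (F : LeviFlat.Structure n 4 M) (hF : F.Orientable)
    {X : Type*} [TopologicalSpace X] [T2Space X] [SecondCountableTopology X]
    [ChartedSpace (Fin (n + 1) → ℂ) X] [IsManifold 𝓘(ℂ, Fin (n + 1) → ℂ) ω X]
    (Ω : Set X) (hΩo : IsOpen Ω) (hΩc : IsConnected Ω) (hΩ : IsCompact (closure Ω))
    (ι : M → X) (hι : LeviFlat.IsRealization F ι) (hM : range ι = frontier Ω)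
    (μ : LeviFlat.TransverseMeasure F 3) :
    ∃ e ∈ F.atlas, ∃ p ∈ e.source, ∃ ζ : Fin n → ℂ, ζ ≠ 0 ∧
      μ.formA e (e p) ζ ≥ n * μ.formTheta e (e p) ζ := by
  by_contra! h
  have hlt : ∀ e ∈ F.atlas, ∀ x ∈ LeviFlat.box n, ∀ ζ : Fin n → ℂ, ζ ≠ 0 →
      μ.formA e x ζ < n * μ.formTheta e x ζ := by
    intro e he x hx ζ hζ
    have := h e he (e.symm x) (F.symm_mem_source he hx) ζ hζ
    rwa [e.right_inv (by rwa [F.target_eq e he])] at this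
  exact μ.false_of_divergence_pos (fun e he x hx => (μ.divergence_pos hn he hx (hlt e he x hx)).1)
    fun e he x hx => (μ.divergence_pos hn he hx (hlt e he x hx)).2
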